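/- **Setting.** All Hilbert spaces are finite-dimensional and nonzero, and all classical variables have finitely many values. A *quantum process* has quantum inputs $A_1,\dots,A_n$, quantum outputs $B_1,\dots,B_m$, setting variables $z=(z_1,\dots,z_r)$ and outcome variables $c=(c_1,\dots,c_s)$ (any of $n,m,r,s$ may be $0$). It is a family $\mathsf T=\{\mathcal F_{c|z}\}$ of completely positive maps $\mathcal F_{c|z}:\mathcal L(\bigotimes_i\mathcal H^{A_i})\to\mathcal L(\bigotimes_j\mathcal H^{B_j})$ such that $\sum_c\mathcal F_{c|z}$ is trace preserving for every $z$. A multipartite state is the special case without quantum inputs, settings and outcomes. **Classicality.** Consider the circuits that contract $\mathsf T$ with an arbitrary state $\rho^{A_i}$ on each quantum input and an arbitrary effect $M^{B_j}$ ($0\le M^{B_j}\le\mathbb 1$) on each quantum output (the factorizing dual processes). $\mathsf T$ is *classical* if these circuits admit a linear, diagram-preserving ontological representation, i.e. if there are finite sets $\Lambda_{A_i},\Lambda_{B_j}$, probability distributions $p(\lambda_{A_i}|\rho^{A_i})$ for all states, response functions $p(M^{B_j}|\lambda_{B_j})\in[0,1]$ for all effects (summing to $1$ over every POVM) and conditional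 distributions $p(c\,\lambda_{\vec B}|z\,\lambda_{\vec A})$ with $$\mathrm{Tr}\Big[\big(\textstyle\bigotimes_jM^{B_j}\big)\mathcal F_{c|z}\big(\bigotimes_i\rho^{A_i}\big)\Big]=\sum_{\lambda_{\vec A},\lambda_{\vec B}}p(c\,\lambda_{\vec B}|z\,\lambda_{\vec A})\prod_jp(M^{B_j}|\lambda_{B_j})\prod_ip(\lambda_{A_i}|\rho^{A_i}),$$ such that every vanishing finite real linear combination of the following quantum objects of one type is also satisfied by their ontological representations: (i) states on one $A_i$; (ii) effects on one $B_j$; (iii) effective processes with a fixed set of open inputs and a fixed set of open outputs, obtained by contracting $\mathcal F_{c|z}$ with states on the other inputs and effects on the other outputs (with $c$, $z$, the states and the effects varying), represented by the corresponding contraction of $p(c\,\lambda_{\vec B}|z\,\lambda_{\vec A})$; (iv) the maps $\mathcal F_{c|z}$ together with the parallel compositions $\bigotimes_\nu\widetilde{\mathcal F}_\nu$ of effective processes as in (iii) whose open inputs and outputs are the blocks of a fixed partition (with possibly empty blocks, indexed by a common index $\nu$) of all inputs and all outputs, represented by the product of the representations of the $\widetilde{\mathcal F}_\nu$. A process is *nonclassical*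 if it is not classical. **Associated state.** Apply the Choi isomorphism to all quantum inputs, flag-convexify all setting variables (sample $z$ from a full-support probability distribution $q$, for instance the uniform one, and output a copy of it) and treat all resulting classical outputs as dephased quantum outputs: $$\rho_{\mathsf T}=\sum_{z,c}q(z)\,\Big(\bigotimes_k|z_k\rangle\langle z_k|\Big)\otimes\Big(\bigotimes_l|c_l\rangle\langle c_l|\Big)\otimes(\mathcal F_{c|z}\otimes\mathrm{id})\big(|\Psi^+\rangle\langle\Psi^+|\big),$$ where $|\Psi^+\rangle$ is the product over $i$ of the normalized maximally entangled states of $A_i$ and a copy of $A_i$. Each setting variable, outcome variable, quantum output and (copy of a) quantum input is one party. **Theorem.** For every quantum process $\mathsf T$ and every full-support probability distribution $q$ on the values of its settings, $\rho_{\mathsf T}$ is a density operator, and $\mathsf T$ is nonclassical if and only if the multipartite state $\rho_{\mathsf T}$ is nonclassical. -/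

import Mathlib

universe u

noncomputable section

open scoped ComplexOrder

namespace QProc

/-! ### Operators on finite-dimensional (multipartite) quantum systems

A family of systems labelled by `ι` is given by the index types `H i` of orthonormal bases: system
`i` has the Hilbert space `ℂ ^ (H i)`, and the composite of all of them has the product basis
`∀ i, H i`. -/

/-- Linear operators on the tensor product `⨂ i, ℂ ^ (H i)`. -/
abbrev Op {ι : Type*} (H : ι → Type u) : Type _ := Matrix (∀ i, H i) (∀ i, H i) ℂ

/-- The tensor product of local operators. -/
def tensorOp {ι : Type*} [Fintype ι] {H : ι → Type u} (X : ∀ i, Matrix (H i) (H i) ℂ) : Op H :=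
  Matrix.of fun a a' => ∏ i, X i (a i) (a' i)

/-- `ρ` is a density operator. -/
def IsDensity {n : Type*} [Fintype n] (ρ : Matrix n n ℂ) : Prop :=
  ρ.PosSemidef ∧ ρ.trace = 1

/-- `M` is an effect: `0 ≤ M ≤ 1`. -/
def IsEffect {n : Type*} [Fintype n] [DecidableEq n] (M : Matrix n n ℂ) : Prop :=
  M.PosSemidef ∧ (1 - M).PosSemidef

/-- The set of states of a system. -/
abbrev DensityOp (n : Type*) [Fintype n] : Type _ := {ρ : Matrix n n ℂ // IsDensity ρ}

/-- The set of effects on a system. -/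
abbrev EffectOp (n : Type*) [Fintype n] [DecidableEq n] : Type _ :=
  {M : Matrix n n ℂ // IsEffect M}

/-- `F ⊗ id` on operators of the original system together with an ancilla with basis `k`. -/
def amplify {m n k : Type*} (F : Matrix m m ℂ →ₗ[ℂ] Matrix n n ℂ)
    (X : Matrix (m × k) (m × k) ℂ) : Matrix (n × k) (n × k) ℂ :=
  Matrix.of fun s s' => F (Matrix.of fun a a' => X (a, s.2) (a', s'.2)) s.1 s'.1

/-- Complete positivity. -/
def IsCP {m n : Type*} [Fintype m] [Fintype n] (F : Matrix m m ℂ →ₗ[ℂ] Matrix n n ℂ) : Prop :=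
  ∀ (k : ℕ) (X : Matrix (m × Fin k) (m × Fin k) ℂ), X.PosSemidef → (amplify F X).PosSemidef

section Classicality

variable {ι κ : Type*} [Fintype ι] [DecidableEq ι] [Fintype κ] [DecidableEq κ]
  {HA : ι → Type u} [∀ i, Fintype (HA i)] [∀ i, DecidableEq (HA i)]
  {HB : κ → Type u} [∀ j, Fintype (HB j)] [∀ j, DecidableEq (HB j)]
  {Z C : Type*} [Fintype Z] [Fintype C]

/-- `F z c` is the map `F_{c|z}` from the quantum inputs to the quantum outputs. The family is a
quantum process (a multipartite multi-instrument) if every `F_{c|z}` is completely positive and, for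
each value `z` of the settings, `∑ c, F_{c|z}` is trace preserving. -/
def IsProcess (F : Z → C → Op HA →ₗ[ℂ] Op HB) : Prop :=
  (∀ z c, IsCP (F z c)) ∧ ∀ z (X : Op HA), (∑ c, F z c X).trace = X.trace

/-! ### Effective processes inside the prepare-transform-measure circuit

The process is contracted with a state on each quantum input and an effect on each quantum output.
Boxing it together with only some of the states and effects gives an effective process, from the
inputs in `S` to the outputs in `T` that are left open. -/

/-- Joins values on the members of `S` and on the non-members of `S`. -/
def glue {σ : Type*} [DecidableEq σ] {β : σ → Type*} (S : Finset σ)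
    (v : ∀ i : {i // i ∈ S}, β i) (w : ∀ i : {i // i ∉ S}, β i) : ∀ i, β i :=
  fun i => if h : i ∈ S then v ⟨i, h⟩ else w ⟨i, h⟩

/-- The part of `f` on the members of `S`. -/
def inside {σ : Type*} {β : σ → Type*} (S : Finset σ) (f : ∀ i, β i) :
    ∀ i : {i // i ∈ S}, β i := fun i => f i

/-- The part of `f` on the non-members of `S`. -/
def outside {σ : Type*} {β : σ → Type*} (S : Finset σ) (f : ∀ i, β i) :
    ∀ i : {i // i ∉ S}, β i := fun i => f i

/-- What labels an effective process with open inputs `S` and open outputs `T`: the states on the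
other inputs, the effects on the other outputs, and the values of the setting and the outcome. -/
structure Label (HA : ι → Type u) [∀ i, Fintype (HA i)]
    (HB : κ → Type u) [∀ j, Fintype (HB j)] [∀ j, DecidableEq (HB j)]
    (Z C : Type*) (S : Finset ι) (T : Finset κ) where
  state : ∀ i : {i // i ∉ S}, DensityOp (HA i)
  effect : ∀ j : {j // j ∉ T}, EffectOp (HB j)
  setting : Z
  outcome : C

/-- The effective process `X ↦ Tr_{Tᶜ} [(1 ⊗ M) F_{c|z} (X ⊗ ρ)]`, where `ρ` is the product of the
states and `M` the product of the effects in the label. -/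
def effMap (F : Z → C → Op HA →ₗ[ℂ] Op HB) {S : Finset ι} {T : Finset κ}
    (l : Label HA HB Z C S T)
    (X : Op fun i : {i // i ∈ S} => HA i) : Op fun j : {j // j ∈ T} => HB j :=
  Matrix.of fun b b' =>
    ∑ β : (∀ j : {j // j ∉ T}, HB j), ∑ β' : (∀ j : {j // j ∉ T}, HB j),
      tensorOp (fun j => (l.effect j).1) β' β *
        F l.setting l.outcome
          (Matrix.of fun a a' => X (inside S a) (inside S a') *
            tensorOp (fun i => (l.state i).1) (outside S a) (outside S a'))
          (glue T b β) (glue T b' β')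

/-- The elements of `σ` that are assigned to the block `ν`. -/
def block {σ : Type*} [Fintype σ] {N : ℕ} (f : σ → Fin N) (ν : Fin N) : Finset σ :=
  Finset.univ.filter fun i => f i = ν

/-- The parallel composition (tensor product of maps) `⨂ ν, E_ν` of effective processes `E_ν`, where
the inputs and the outputs are distributed over the blocks `ν` by `f` and `g` and `E_ν` goes from
the inputs to the outputs of block `ν`; it is again a map from all inputs to all outputs. -/
def parMap (F : Z → C → Op HA →ₗ[ℂ] Op HB) {N : ℕ} (f : ι → Fin N) (g : κ → Fin N)
    (l : ∀ ν, Label HA HB Z C (block f ν) (block g ν)) (X : Op HA) : Op HB :=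
  Matrix.of fun b b' => ∑ a, ∑ a', X a a' *
    ∏ ν, effMap F (l ν)
      (Matrix.single (inside (block f ν) a) (inside (block f ν) a') 1)
      (inside (block g ν) b) (inside (block g ν) b')

/-! ### Ontological models -/

/-- The data of a diagram-preserving ontological representation of all the circuits that contract
the process with a state on each quantum input and an effect on each quantum output: a finite ontic
state space for each quantum system, and
`prep i ρ x = p(x | ρ)`, `resp j M y = p(M | y)`, `trans z c x y = p(c, y | z, x)`. -/
structure OntModel (HA : ι → Type u) [∀ i, Fintype (HA i)]
    (HB : κ → Type u) [∀ j, Fintype (HB j)] [∀ j, DecidableEq (HB j)] (Z C : Type*) where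
  ΛA : ι → Type u
  ΛB : κ → Type u
  finA : ∀ i, Fintype (ΛA i)
  finB : ∀ j, Fintype (ΛB j)
  prep : ∀ i, DensityOp (HA i) → ΛA i → ℝ
  resp : ∀ j, EffectOp (HB j) → ΛB j → ℝ
  trans : Z → C → (∀ i, ΛA i) → (∀ j, ΛB j) → ℝ

attribute [instance] OntModel.finA OntModel.finB

/-- The ontological representation of an effective process, obtained by composing the ontological
representations of its constituents. -/
def OntModel.eff (m : OntModel HA HB Z C) {S : Finset ι} {T : Finset κ} (l : Label HA HB Z C S T)
    (x : ∀ i : {i // i ∈ S}, m.ΛA i) (y : ∀ j : {j // j ∈ T}, m.ΛB j) : ℝ :=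
  ∑ x' : (∀ i : {i // i ∉ S}, m.ΛA i), ∑ y' : (∀ j : {j // j ∉ T}, m.ΛB j),
    m.trans l.setting l.outcome (glue S x x') (glue T y y') *
      (∏ j : {j // j ∉ T}, m.resp j (l.effect j) (y' j)) *
        ∏ i : {i // i ∉ S}, m.prep i (l.state i) (x' i)

/-- The ontological representation of a parallel composition of effective processes. -/
def OntModel.par (m : OntModel HA HB Z C) {N : ℕ} (f : ι → Fin N) (g : κ → Fin N)
    (l : ∀ ν, Label HA HB Z C (block f ν) (block g ν))
    (x : ∀ i, m.ΛA i) (y : ∀ j, m.ΛB j) : ℝ :=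
  ∏ ν, m.eff (l ν) (inside (block f ν) x) (inside (block g ν) y)

/-- The model consists of (sub)stochastic matrices, reproduces the quantum statistics, and is linear:
every operational identity (a vanishing finite real linear combination) among the states, among the
effects, among the effective processes obtained by sequential composition, and between the given
process and parallel compositions of such effective processes is respected. -/
structure OntModel.Explains (m : OntModel HA HB Z C) (F : Z → C → Op HA →ₗ[ℂ] Op HB) : Prop where
  prep_nonneg : ∀ i ρ x, 0 ≤ m.prep i ρ x
  prep_sum : ∀ i ρ, ∑ x, m.prep i ρ x = 1
  resp_nonneg : ∀ j M y, 0 ≤ m.resp j M y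
  resp_le_one : ∀ j M y, m.resp j M y ≤ 1
  resp_sum : ∀ j (n : ℕ) (M : Fin n → EffectOp (HB j)), ∑ b, (M b).1 = 1 →
    ∀ y, ∑ b, m.resp j (M b) y = 1
  trans_nonneg : ∀ z c x y, 0 ≤ m.trans z c x y
  trans_sum : ∀ z x, ∑ c, ∑ y, m.trans z c x y = 1
  reproduces : ∀ (ρ : ∀ i, DensityOp (HA i)) (M : ∀ j, EffectOp (HB j)) z c,
    (tensorOp (fun j => (M j).1) * F z c (tensorOp fun i => (ρ i).1)).trace =
      ((∑ x, ∑ y, m.trans z c x y * (∏ j, m.resp j (M j) (y j)) * ∏ i, m.prep i (ρ i) (x i) : ℝ) : ℂ)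
  prep_linear : ∀ i (α : DensityOp (HA i) →₀ ℝ), (α.sum fun ρ r => r • ρ.1) = 0 →
    ∀ x, (α.sum fun ρ r => r * m.prep i ρ x) = 0
  resp_linear : ∀ j (α : EffectOp (HB j) →₀ ℝ), (α.sum fun M r => r • M.1) = 0 →
    ∀ y, (α.sum fun M r => r * m.resp j M y) = 0
  seq_linear : ∀ (S : Finset ι) (T : Finset κ) (α : Label HA HB Z C S T →₀ ℝ),
    (∀ X, (α.sum fun l r => r • effMap F l X) = 0) →
      ∀ x y, (α.sum fun l r => r * m.eff l x y) = 0
  par_linear : ∀ (N : ℕ) (f : ι → Fin N) (g : κ → Fin N) (α₀ : Z → C → ℝ)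
    (α : (∀ ν, Label HA HB Z C (block f ν) (block g ν)) →₀ ℝ),
    (∀ X, (∑ z, ∑ c, α₀ z c • F z c X) + (α.sum fun l r => r • parMap F f g l X) = 0) →
      ∀ x y, (∑ z, ∑ c, α₀ z c * m.trans z c x y) + (α.sum fun l r => r * m.par f g l x y) = 0

/-- A process is classical if the statistics generated by contracting it with all factorizing dual
processes (a state on each quantum input and an effect on each quantum output) are classically
explainable. -/
def IsClassical (F : Z → C → Op HA →ₗ[ℂ] Op HB) : Prop :=
  ∃ m : OntModel HA HB Z C, m.Explains F

/-- A process is nonclassical if it is not classical. -/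
def IsNonclassical (F : Z → C → Op HA →ₗ[ℂ] Op HB) : Prop := ¬ IsClassical F

end Classicality

/-! ### The associated multipartite state -/

/-- Two families of systems, put next to each other. -/
def SumSys {σ τ : Type*} (H : σ → Type u) (K : τ → Type u) : σ ⊕ τ → Type u
  | Sum.inl i => H i
  | Sum.inr j => K j

instance {σ τ : Type*} (H : σ → Type u) (K : τ → Type u) [∀ i, Fintype (H i)]
    [∀ j, Fintype (K j)] : ∀ s, Fintype (SumSys H K s)
  | Sum.inl i => inferInstanceAs (Fintype (H i))
  | Sum.inr j => inferInstanceAs (Fintype (K j))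

instance {σ τ : Type*} (H : σ → Type u) (K : τ → Type u) [∀ i, DecidableEq (H i)]
    [∀ j, DecidableEq (K j)] : ∀ s, DecidableEq (SumSys H K s)
  | Sum.inl i => inferInstanceAs (DecidableEq (H i))
  | Sum.inr j => inferInstanceAs (DecidableEq (K j))

/-- The first components of a joint value. -/
def leftPart {σ τ : Type*} {H : σ → Type u} {K : τ → Type u} (s : ∀ p, SumSys H K p) : ∀ i, H i :=
  fun i => s (Sum.inl i)

/-- The last components of a joint value. -/
def rightPart {σ τ : Type*} {H : σ → Type u} {K : τ → Type u} (s : ∀ p, SumSys H K p) : ∀ j, K j :=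
  fun j => s (Sum.inr j)

/-- The tensor product of operators on two families of systems. -/
def tensor {σ τ : Type*} {H : σ → Type u} {K : τ → Type u} (X : Op H) (Y : Op K) :
    Op (SumSys H K) :=
  Matrix.of fun s s' => X (leftPart s) (leftPart s') * Y (rightPart s) (rightPart s')

/-- The Choi isomorphism on all quantum inputs: `(F ⊗ id) |Ψ⁺⟩⟨Ψ⁺|`, an operator on the outputs
together with copies of the inputs, where `|Ψ⁺⟩⟨Ψ⁺| = d⁻¹ ∑ a a', |a⟩⟨a'| ⊗ |a⟩⟨a'|` is the product
over the inputs of the maximally entangled states and `d` is the product of their dimensions. -/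
def choi {ι κ : Type*} [Fintype ι] [DecidableEq ι]
    {HA : ι → Type u} [∀ i, Fintype (HA i)] [∀ i, DecidableEq (HA i)] {HB : κ → Type u}
    (F : Op HA →ₗ[ℂ] Op HB) : Op (SumSys HB HA) :=
  (Fintype.card (∀ i, HA i) : ℂ)⁻¹ •
    ∑ a, ∑ a', tensor (F (Matrix.single a a' 1)) (Matrix.single a a' 1)

/-- Flag-convexification of all setting variables: they are sampled from the distribution `q`, and
copies of them become outcome variables. -/
def flagConvexify {ζ γ σ : Type*} {Zv : ζ → Type u} {Cv : γ → Type u} {H : σ → Type u}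
    (q : (∀ k, Zv k) → ℝ) (E : (∀ k, Zv k) → (∀ l, Cv l) → Op H) :
    (∀ p, SumSys Zv Cv p) → Op H :=
  fun s => q (leftPart s) • E (leftPart s) (rightPart s)

/-- Outcome variables as dephased quantum outputs: `∑ c, |c⟩⟨c| ⊗ E_c`, where each outcome variable
becomes a quantum system whose basis is the set of its values. -/
def dephase {γ σ : Type*} [Fintype γ] [DecidableEq γ] {Cv : γ → Type u} [∀ l, Fintype (Cv l)]
    [∀ l, DecidableEq (Cv l)] {H : σ → Type u} (E : (∀ l, Cv l) → Op H) : Op (SumSys Cv H) :=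
  ∑ c, tensor (Matrix.single c c 1) (E c)

/-- The multipartite state associated with a process with setting variables of value sets `Zv k`,
outcome variables of value sets `Cv l`, quantum inputs `HA i` and quantum outputs `HB j`:
`∑ z c, q z |z⟩⟨z| ⊗ |c⟩⟨c| ⊗ (F_{c|z} ⊗ id) |Ψ⁺⟩⟨Ψ⁺|`. Each setting variable, each outcome variable,
each quantum output and each quantum input gives one party. -/
def associatedState {ζ γ ι κ : Type*} [Fintype ζ] [DecidableEq ζ] [Fintype γ] [DecidableEq γ]
    [Fintype ι] [DecidableEq ι]
    {Zv : ζ → Type u} [∀ k, Fintype (Zv k)] [∀ k, DecidableEq (Zv k)]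
    {Cv : γ → Type u} [∀ l, Fintype (Cv l)] [∀ l, DecidableEq (Cv l)]
    {HA : ι → Type u} [∀ i, Fintype (HA i)] [∀ i, DecidableEq (HA i)] {HB : κ → Type u}
    (q : (∀ k, Zv k) → ℝ) (F : (∀ k, Zv k) → (∀ l, Cv l) → Op HA →ₗ[ℂ] Op HB) :
    Op (SumSys (SumSys Zv Cv) (SumSys HB HA)) :=
  dephase (flagConvexify q fun z c => choi (F z c))

/-- The family of no systems. -/
def NoSys : Empty → Type u := fun e => e.elim

instance : ∀ e, Fintype (NoSys e) := fun e => e.elim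

instance : ∀ e, DecidableEq (NoSys e) := fun e => e.elim

/-- A state as a process without quantum inputs and without settings and outcomes: the operators on
no systems are the scalars, and the process sends the scalar `t` to `t • ρ`. -/
def stateProcess {σ : Type*} {H : σ → Type u} (ρ : Op H) :
    Unit → Unit → Op NoSys →ₗ[ℂ] Op H :=
  fun _ _ => (Matrix.traceLinearMap (∀ e, NoSys e) ℂ ℂ).smulRight ρ

end QProc

end

universe v w

noncomputable section

open scoped ComplexOrder Matrix

set_option linter.unusedSectionVars false

namespace QProc

/-! A classical model is the same thing as a `Frame`. On every input the map `X ↦ ∑ x, e x X • G x`,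
and on every output the map `M ↦ ∑ y, s y M • D y`, can be inserted without changing any factorizing
statistics, and the coefficients of the process with respect to `G` and `D` form a conditional
distribution. The functionals `e` and `s` are positive and normalized; `G` and `D` need not be
positive, only the coefficients must be.

A frame gives a model because every ontological object is then a linear function of its quantum
counterpart (`Frame.explains_model`). Conversely, linearity of a model extends preparations and
responses to functionals `e` and `s`. Linearity for effective processes with a single open wire
makes the ontological weight on that wire a linear function of the functional that the rest of the
circuit induces there; in finite dimension such a function is evaluation at an operator, which is `G
x` or `D y`. Each `F z c` is a linear combination of products of single-wire functionals, so
linearity under parallel composition forces the transition probabilities to be the pairings of `F z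
c` with the `G x` and `D y` (`trans_eq_pair`).

Frames pass between the process and its state because contracting the Choi operator with `Y` on the
copy of an input amounts to inserting `Yᵀ` into that input. An input pair `(e, G)` becomes the pair
`(e(·ᵀ) / e(1), e(1) Gᵀ)` on the copy, and a pair `(s, D)` on the copy becomes `(tr D · s(·ᵀ), Dᵀ /
tr D)` on the input. The normalizations agree because trace preservation makes the marginal on the
copies maximally mixed. Where a weight `e(1)` or `tr D` vanishes, positivity makes the corresponding
term vanish altogether, so any default serves. Settings and outcomes are diagonal and carry the
frame of basis projections; full support of `q` allows `F z c` to be recovered by projecting on `z`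
and `c`. -/

theorem ofReal_re_of_nonneg {r : ℂ} (h : 0 ≤ r) : ((r.re : ℝ) : ℂ) = r :=
  Complex.ext rfl (by simpa using (Complex.le_def.1 h).2)

theorem posSemidef_single {n : Type*} [DecidableEq n] (a : n) :
    (Matrix.single a a (1 : ℂ)).PosSemidef := by
  rw [← Matrix.diagonal_single]
  refine Matrix.PosSemidef.diagonal fun d => ?_
  by_cases h : d = a
  · subst h; simp
  · simp [h]

theorem inv_natCast_nonneg (n : ℕ) : (0 : ℂ) ≤ (n : ℂ)⁻¹ := by
  rw [← Complex.ofReal_natCast, ← Complex.ofReal_inv]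
  exact_mod_cast inv_nonneg.2 (Nat.cast_nonneg _)

theorem inv_nonneg_of_nonneg {r : ℂ} (hr : 0 ≤ r) : 0 ≤ r⁻¹ := by
  rw [← ofReal_re_of_nonneg hr, ← Complex.ofReal_inv]
  exact_mod_cast inv_nonneg.2 (Complex.le_def.1 hr).1

/-! ### Pure states span the operators -/

section Pure

variable {n : Type*} [Fintype n] [DecidableEq n]

/-- Rank-one orthogonal projections. -/
def IsPure (P : Matrix n n ℂ) : Prop := IsDensity P ∧ P * P = P

theorem IsPure.isEffect {P : Matrix n n ℂ} (h : IsPure P) : IsEffect P := by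
  refine ⟨h.1.1, ?_⟩
  have hP : Pᴴ = P := h.1.1.isHermitian
  have : (1 - P).conjTranspose * (1 - P) = 1 - P := by
    rw [Matrix.conjTranspose_sub, hP, Matrix.conjTranspose_one, sub_mul, mul_sub, mul_sub, h.2]
    simp
  rw [← this]
  exact Matrix.posSemidef_conjTranspose_mul_self _

theorem exists_pure_smul_eq (v : n → ℂ) (hv : v ≠ 0) :
    ∃ (t : ℝ) (P : Matrix n n ℂ), 0 ≤ t ∧ IsPure P ∧
      Matrix.vecMulVec v (star v) = (t : ℂ) • P := by
  have h0 : 0 ≤ star v ⬝ᵥ v := dotProduct_star_self_nonneg v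
  have hne : star v ⬝ᵥ v ≠ 0 := by simpa using hv
  obtain ⟨t, ht, hte⟩ : ∃ t : ℝ, 0 ≤ t ∧ (t : ℂ) = star v ⬝ᵥ v := by
    refine ⟨(star v ⬝ᵥ v).re, (Complex.le_def.1 h0).1, ?_⟩
    exact Complex.ext rfl (by simpa using (Complex.le_def.1 h0).2)
  rw [← hte] at hne
  refine ⟨t, (t : ℂ)⁻¹ • Matrix.vecMulVec v (star v), ht, ⟨⟨?_, ?_⟩, ?_⟩, ?_⟩
  · refine (Matrix.posSemidef_vecMulVec_self_star v).smul ?_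
    have : (0 : ℂ) ≤ ((t⁻¹ : ℝ) : ℂ) := by exact_mod_cast inv_nonneg.2 ht
    simpa using this
  · rw [Matrix.trace_smul, Matrix.trace_vecMulVec, dotProduct_comm, ← hte, smul_eq_mul,
      inv_mul_cancel₀ hne]
  · rw [Matrix.smul_mul, Matrix.mul_smul, Matrix.vecMulVec_mul_vecMulVec, ← hte,
      Matrix.vecMulVec_smul, smul_smul, smul_smul]
    congr 1
    field_simp
  · rw [smul_smul, mul_inv_cancel₀ hne, one_smul]

/-- Matrix units have the form `v w*`, and polarization reduces these to `u u*`, which is a multiple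
of a projection. Pure projections are at once states and effects, so identities between multilinear
expressions can be tested where they are statements about probabilities. -/
theorem span_pure : Submodule.span ℂ {P : Matrix n n ℂ | IsPure P} = ⊤ := by
  have hr : ∀ v : n → ℂ, Matrix.vecMulVec v (star v) ∈
      Submodule.span ℂ {P : Matrix n n ℂ | IsPure P} := by
    intro v
    by_cases hv : v = 0
    · simp [hv]
    · obtain ⟨t, P, -, hP, h⟩ := exists_pure_smul_eq v hv
      rw [h]
      exact Submodule.smul_mem _ _ (Submodule.subset_span hP)
  -- Polarization identity over the four vectors `v ± w`, `v ± i w`.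
  have hpol : ∀ v w : n → ℂ, Matrix.vecMulVec v (star w) = (4⁻¹ : ℂ) •
      (Matrix.vecMulVec (v + w) (star (v + w))
        - Matrix.vecMulVec (v - w) (star (v - w))
        + Complex.I • Matrix.vecMulVec (v + Complex.I • w) (star (v + Complex.I • w))
        - Complex.I • Matrix.vecMulVec (v - Complex.I • w) (star (v - Complex.I • w))) := by
    intro v w
    ext a b
    simp [Matrix.vecMulVec_apply]
    ring_nf
    simp
    ring
  rw [eq_top_iff]
  rintro M -
  rw [Matrix.matrix_eq_sum_single M]
  refine Submodule.sum_mem _ fun a _ => Submodule.sum_mem _ fun b _ => ?_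
  have : Matrix.single a b (M a b) =
      M a b • Matrix.vecMulVec (Pi.single a 1) (star (Pi.single b (1 : ℂ))) := by
    ext a' b'
    simp only [Matrix.single_apply, Matrix.smul_apply, Matrix.vecMulVec_apply, Pi.star_apply,
      Pi.single_apply, smul_eq_mul]
    by_cases ha : a = a' <;> by_cases hb : b = b' <;> simp [ha, hb, eq_comm (a := a'),
      eq_comm (a := b')]
  rw [this, hpol]
  refine Submodule.smul_mem _ _ (Submodule.smul_mem _ _ ?_)
  exact Submodule.sub_mem _ (Submodule.add_mem _ (Submodule.sub_mem _ (hr _) (hr _))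
    (Submodule.smul_mem _ _ (hr _))) (Submodule.smul_mem _ _ (hr _))

/-- A linear functional that is nonnegative on pure states is nonnegative on positive operators. -/
theorem nonneg_of_nonneg_pure (f : Matrix n n ℂ →ₗ[ℂ] ℂ) (hf : ∀ P, IsPure P → 0 ≤ f P)
    {M : Matrix n n ℂ} (hM : M.PosSemidef) : 0 ≤ f M := by
  obtain ⟨m, v, rfl⟩ := Matrix.posSemidef_iff_eq_sum_vecMulVec.1 hM
  rw [map_sum]
  refine Finset.sum_nonneg fun k _ => ?_
  by_cases hv : v k = 0
  · rw [hv]; simp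
  · obtain ⟨t, P, ht, hP, h⟩ := exists_pure_smul_eq _ hv
    rw [h, map_smul, smul_eq_mul]
    exact mul_nonneg (by exact_mod_cast ht) (hf P hP)

theorem linearMap_eq_of_eq_pure {V : Type*} [AddCommGroup V] [Module ℂ V]
    {f g : Matrix n n ℂ →ₗ[ℂ] V} (h : ∀ P, IsPure P → f P = g P) : f = g :=
  LinearMap.ext_on span_pure h

/-- A positive functional that vanishes at the identity vanishes. -/
theorem eq_zero_of_apply_one (f : Matrix n n ℂ →ₗ[ℂ] ℂ)
    (hf : ∀ P : Matrix n n ℂ, P.PosSemidef → 0 ≤ f P) (h1 : f 1 = 0) : f = 0 := by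
  refine linearMap_eq_of_eq_pure fun P hP => ?_
  have h2 := hf _ hP.isEffect.2
  rw [map_sub, h1, zero_sub] at h2
  exact le_antisymm (by simpa using h2) (hf _ hP.1.1)

end Pure

/-! ### Multilinear algebra -/

/-- Slots are released from the spanning sets one at a time: in the slot being released both sides
are linear maps that agree on a spanning set. -/
theorem multilinear_eq_of_span {R ι W : Type*} {V : ι → Type*} [CommRing R] [Fintype ι]
    [∀ i, AddCommGroup (V i)] [∀ i, Module R (V i)] [AddCommGroup W] [Module R W]
    {f g : MultilinearMap R V W} {S : ∀ i, Set (V i)} (hS : ∀ i, Submodule.span R (S i) = ⊤)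
    (h : ∀ m, (∀ i, m i ∈ S i) → f m = g m) : f = g := by
  classical
  have key : ∀ (s : Finset ι) (m : ∀ i, V i), (∀ i, i ∉ s → m i ∈ S i) → f m = g m := by
    intro s
    induction s using Finset.induction_on with
    | empty => exact fun m hm => h m fun i => hm i (by simp)
    | insert i s hi ih =>
      intro m hm
      have : f.toLinearMap m i = g.toLinearMap m i := by
        refine LinearMap.ext_on (hS i) fun x hx => ?_
        refine ih _ fun j hj => ?_
        by_cases hji : j = i
        · subst hji; simpa using hx
        · simpa [hji] using hm j (by simp [hji, hj])
      simpa using congrArg (fun F => F (m i)) this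
  exact MultilinearMap.ext fun m => key Finset.univ m fun i hi => absurd (Finset.mem_univ i) hi

/-- If every slot of a multilinear map may be resolved by `π i`, then any set of slots may. -/
theorem multilinear_resolve {R ι W : Type*} {V : ι → Type*} [CommRing R] [Fintype ι]
    [DecidableEq ι] [∀ i, AddCommGroup (V i)] [∀ i, Module R (V i)] [AddCommGroup W] [Module R W]
    (f : MultilinearMap R V W) (π : ∀ i, V i → V i)
    (h : ∀ i m, f (Function.update m i (π i (m i))) = f m) (m m' : ∀ i, V i)
    (hm : ∀ i, m' i = m i ∨ m' i = π i (m i)) : f m' = f m := by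
  have key : ∀ s : Finset ι, f (s.piecewise m' m) = f m := by
    intro s
    induction s using Finset.induction_on with
    | empty => simp
    | insert i s hi ih =>
      rw [Finset.piecewise_insert, ← ih]
      rcases hm i with hi' | hi'
      · rw [hi']
        congr 1
        exact Function.update_eq_self_iff.2 (by simp [hi])
      · rw [hi']
        have := h i (s.piecewise m' m)
        simpa [hi] using this
  simpa using key Finset.univ

/-- Values of a multilinear map on linear combinations in every slot. -/
theorem multilinear_expand {R ι W : Type*} {V : ι → Type*} [CommRing R] [Fintype ι]
    [DecidableEq ι] [∀ i, AddCommGroup (V i)] [∀ i, Module R (V i)] [AddCommGroup W] [Module R W]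
    (f : MultilinearMap R V W) {Λ : ι → Type*} [∀ i, Fintype (Λ i)]
    (c : ∀ i, Λ i → R) (v : ∀ i, Λ i → V i) :
    f (fun i => ∑ x, c i x • v i x) = ∑ x : ∀ i, Λ i, (∏ i, c i (x i)) • f fun i => v i (x i) := by
  rw [MultilinearMap.map_sum]
  exact Finset.sum_congr rfl fun x _ => f.map_smul_univ _ _

/-! ### The pairing of a map with product operators -/

section Pairing

variable {ι κ : Type*} [Fintype ι] [DecidableEq ι] [Fintype κ] [DecidableEq κ]
  {HA : ι → Type u} [∀ i, Fintype (HA i)] [∀ i, DecidableEq (HA i)]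
  {HB : κ → Type u} [∀ j, Fintype (HB j)] [∀ j, DecidableEq (HB j)]

/-- The tensor product of local operators as a multilinear map. -/
def tensorOpMultilinear {σ : Type*} [Fintype σ] (H : σ → Type u) :
    MultilinearMap ℂ (fun i => Matrix (H i) (H i) ℂ) (Op H) :=
  (Matrix.ofLinearEquiv ℂ).toLinearMap.compMultilinearMap
    (MultilinearMap.pi fun a => MultilinearMap.pi fun a' =>
      (MultilinearMap.mkPiAlgebra ℂ σ ℂ).compLinearMap
        fun i => Matrix.entryLinearMap ℂ ℂ (a i) (a' i))

theorem tensorOpMultilinear_apply {σ : Type*} [Fintype σ] {H : σ → Type u}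
    (X : ∀ i, Matrix (H i) (H i) ℂ) : tensorOpMultilinear H X = tensorOp X := by
  ext a a'
  simp [tensorOpMultilinear, tensorOp]

theorem tensorOp_single {σ : Type*} [Fintype σ] [DecidableEq σ] {H : σ → Type u}
    [∀ i, DecidableEq (H i)] (a a' : ∀ i, H i) :
    tensorOp (fun i => Matrix.single (a i) (a' i) (1 : ℂ)) = Matrix.single a a' 1 := by
  ext b b'
  simp only [tensorOp, Matrix.of_apply, Matrix.single_apply, Finset.prod_ite_zero, funext_iff]
  simp [forall_and]

theorem tensorOp_one {σ : Type*} [Fintype σ] [DecidableEq σ] {H : σ → Type u}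
    [∀ i, DecidableEq (H i)] :
    tensorOp (fun i => (1 : Matrix (H i) (H i) ℂ)) = 1 := by
  ext b b'
  simp only [tensorOp, Matrix.of_apply, Matrix.one_apply, Finset.prod_ite_zero, funext_iff]
  simp

theorem trace_tensorOp {σ : Type*} [Fintype σ] [DecidableEq σ] {H : σ → Type u}
    [∀ i, Fintype (H i)] (X : ∀ i, Matrix (H i) (H i) ℂ) :
    (tensorOp X).trace = ∏ i, (X i).trace := by
  simp only [Matrix.trace, tensorOp, Matrix.diag_apply, Matrix.of_apply]
  exact (Fintype.prod_sum fun i (a : H i) => X i a a).symm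

/-- The number that results from contracting the map `A` with local operators on all inputs and all
outputs. -/
def pair (A : Op HA →ₗ[ℂ] Op HB) (X : ∀ i, Matrix (HA i) (HA i) ℂ)
    (M : ∀ j, Matrix (HB j) (HB j) ℂ) : ℂ :=
  (tensorOp M * A (tensorOp X)).trace

/-- The pairing as a multilinear map of the operators on the inputs. -/
def pairInput (A : Op HA →ₗ[ℂ] Op HB) (M : ∀ j, Matrix (HB j) (HB j) ℂ) :
    MultilinearMap ℂ (fun i => Matrix (HA i) (HA i) ℂ) ℂ :=
  (Matrix.traceLinearMap _ ℂ ℂ ∘ₗ LinearMap.mulLeft ℂ (tensorOp M) ∘ₗ A).compMultilinearMap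
    (tensorOpMultilinear HA)

/-- The pairing as a multilinear map of the operators on the outputs. -/
def pairOutput (A : Op HA →ₗ[ℂ] Op HB) (X : ∀ i, Matrix (HA i) (HA i) ℂ) :
    MultilinearMap ℂ (fun j => Matrix (HB j) (HB j) ℂ) ℂ :=
  (Matrix.traceLinearMap _ ℂ ℂ ∘ₗ LinearMap.mulRight ℂ (A (tensorOp X))).compMultilinearMap
    (tensorOpMultilinear HB)

theorem pairInput_apply (A : Op HA →ₗ[ℂ] Op HB) (X : ∀ i, Matrix (HA i) (HA i) ℂ)
    (M : ∀ j, Matrix (HB j) (HB j) ℂ) : pairInput A M X = pair A X M := by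
  simp [pairInput, pair, tensorOpMultilinear_apply]

theorem pairOutput_apply (A : Op HA →ₗ[ℂ] Op HB) (X : ∀ i, Matrix (HA i) (HA i) ℂ)
    (M : ∀ j, Matrix (HB j) (HB j) ℂ) : pairOutput A X M = pair A X M := by
  simp [pairOutput, pair, tensorOpMultilinear_apply]

/-- The pairing as a linear map of the map. -/
def pairMap (X : ∀ i, Matrix (HA i) (HA i) ℂ) (M : ∀ j, Matrix (HB j) (HB j) ℂ) :
    (Op HA →ₗ[ℂ] Op HB) →ₗ[ℂ] ℂ :=
  Matrix.traceLinearMap _ ℂ ℂ ∘ₗ LinearMap.mulLeft ℂ (tensorOp M) ∘ₗ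
    LinearMap.applyₗ (tensorOp X)

theorem pairMap_apply (A : Op HA →ₗ[ℂ] Op HB) (X : ∀ i, Matrix (HA i) (HA i) ℂ)
    (M : ∀ j, Matrix (HB j) (HB j) ℂ) : pairMap X M A = pair A X M := by
  simp [pairMap, pair]

theorem pair_single (A : Op HA →ₗ[ℂ] Op HB) (a a' : ∀ i, HA i) (b b' : ∀ j, HB j) :
    pair A (fun i => Matrix.single (a i) (a' i) 1) (fun j => Matrix.single (b j) (b' j) 1) =
      A (Matrix.single a a' 1) b' b := by
  simp [pair, tensorOp_single, Matrix.trace_single_mul]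

theorem map_ext_single {A B : Op HA →ₗ[ℂ] Op HB}
    (h : ∀ a a' b b', A (Matrix.single a a' 1) b b' = B (Matrix.single a a' 1) b b') : A = B := by
  refine Matrix.ext_linearMap ℂ fun a a' => LinearMap.ext_ring ?_
  ext b b'
  exact h a a' b b'

/-- Matrix entries of tensor products are products over the parties, so in this form the pairing of
a parallel composition splits along the blocks. -/
theorem pair_eq_sum (A : Op HA →ₗ[ℂ] Op HB) (X : ∀ i, Matrix (HA i) (HA i) ℂ)
    (M : ∀ j, Matrix (HB j) (HB j) ℂ) :
    pair A X M = ∑ a, ∑ a', ∑ b, ∑ b', tensorOp X a a' * tensorOp M b' b *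
      A (Matrix.single a a' 1) b b' := by
  have hX : tensorOp X = ∑ a, ∑ a', tensorOp X a a' • Matrix.single a a' (1 : ℂ) := by
    conv_lhs => rw [Matrix.matrix_eq_sum_single (tensorOp X)]
    simp
  rw [pair, hX]
  simp only [map_sum, map_smul, Matrix.mul_sum, Matrix.mul_smul, Matrix.trace_sum,
    Matrix.trace_smul, smul_eq_mul]
  rw [← hX]
  refine Finset.sum_congr rfl fun a _ => Finset.sum_congr rfl fun a' _ => ?_
  simp only [Matrix.trace, Matrix.diag_apply, Matrix.mul_apply, Finset.mul_sum]
  rw [Finset.sum_comm]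
  simp only [mul_assoc]

theorem eq_of_pair_eq {A B : Op HA →ₗ[ℂ] Op HB} (h : ∀ X M, pair A X M = pair B X M) : A = B :=
  map_ext_single fun a a' b b' => by rw [← pair_single, h, pair_single]

/-- Local tomography: pure projections span in every slot. The outputs are released while the inputs
are still pure, then the inputs. -/
theorem eq_of_pair_eq_pure {A B : Op HA →ₗ[ℂ] Op HB}
    (h : ∀ X M, (∀ i, IsPure (X i)) → (∀ j, IsPure (M j)) → pair A X M = pair B X M) : A = B := by
  refine eq_of_pair_eq fun X M => ?_
  have h1 : ∀ X, (∀ i, IsPure (X i)) → pairOutput A X = pairOutput B X := fun X hX =>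
    multilinear_eq_of_span (fun j => span_pure) fun M hM => by
      simpa only [pairOutput_apply] using h X M hX hM
  have h2 : pairInput A M = pairInput B M :=
    multilinear_eq_of_span (fun i => span_pure) fun X hX => by
      simpa only [pairOutput_apply, pairInput_apply] using congrArg (fun f => f M) (h1 X hX)
  simpa only [pairInput_apply] using congrArg (fun f => f X) h2

end Pairing

/-! ### Partial families -/

section Glue

variable {σ : Type*} [DecidableEq σ] {β : σ → Type*} (S : Finset σ)

@[simp]
theorem inside_glue (v : ∀ i : {i // i ∈ S}, β i) (w : ∀ i : {i // i ∉ S}, β i) :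
    inside S (glue S v w) = v := by
  funext i
  simp [inside, glue, i.2]

@[simp]
theorem outside_glue (v : ∀ i : {i // i ∈ S}, β i) (w : ∀ i : {i // i ∉ S}, β i) :
    outside S (glue S v w) = w := by
  funext i
  simp [outside, glue, i.2]

theorem glue_of_mem (v : ∀ i : {i // i ∈ S}, β i) (w : ∀ i : {i // i ∉ S}, β i) {i : σ}
    (h : i ∈ S) : glue S v w i = v ⟨i, h⟩ := by
  simp [glue, h]

theorem glue_of_notMem (v : ∀ i : {i // i ∈ S}, β i) (w : ∀ i : {i // i ∉ S}, β i) {i : σ}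
    (h : i ∉ S) : glue S v w i = w ⟨i, h⟩ := by
  simp [glue, h]

theorem sum_glue [Fintype σ] [∀ i, Fintype (β i)] {R : Type*} [AddCommMonoid R]
    (f : (∀ i, β i) → R) :
    ∑ v, f v = ∑ v : (∀ i : {i // i ∈ S}, β i), ∑ w : (∀ i : {i // i ∉ S}, β i),
      f (glue S v w) := by
  rw [← Equiv.sum_comp (Equiv.piEquivPiSubtypeProd (· ∈ S) β).symm, Fintype.sum_prod_type]
  rfl

theorem prod_glue [Fintype σ] {R : Type*} [CommMonoid R] {γ : σ → Type*}
    (f : ∀ i, β i → γ i → R) (v : ∀ i : {i // i ∈ S}, β i) (w : ∀ i : {i // i ∉ S}, β i)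
    (a : ∀ i, γ i) :
    ∏ i, f i (glue S v w i) (a i) =
      (∏ i : {i // i ∈ S}, f i (v i) (a i)) * ∏ i : {i // i ∉ S}, f i (w i) (a i) := by
  rw [← Fintype.prod_subtype_mul_prod_subtype (· ∈ S) fun i => f i (glue S v w i) (a i)]
  congr 1
  · refine Finset.prod_congr (Finset.ext fun _ => by simp) fun i _ => ?_
    rw [glue_of_mem S v w i.2]
  · refine Finset.prod_congr (Finset.ext fun _ => by simp) fun i _ => ?_
    rw [glue_of_notMem S v w i.2]

/-- A joint value is the same as a joint value on each of the blocks. -/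
def blockEquiv {σ : Type*} [Fintype σ] {N : ℕ} (f : σ → Fin N) (β : σ → Type*) :
    (∀ i, β i) ≃ ∀ ν, ∀ i : {i // i ∈ block f ν}, β i where
  toFun a ν := inside (block f ν) a
  invFun w i := w (f i) ⟨i, by simp [block]⟩
  left_inv a := rfl
  right_inv w := by
    funext ν ⟨i, hi⟩
    obtain rfl : f i = ν := by simpa [block] using hi
    rfl

theorem prod_block {σ : Type*} [Fintype σ] {R : Type*} [CommMonoid R] {N : ℕ} (f : σ → Fin N)
    (a : σ → R) : ∏ ν, ∏ i : {i // i ∈ block f ν}, a i = ∏ i, a i := by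
  rw [← Finset.prod_fiberwise Finset.univ f a]
  refine Fintype.prod_congr _ _ fun ν => ?_
  exact Finset.prod_coe_sort (block f ν) a

end Glue

/-! ### Effective processes and their pairings -/

section Effective

variable {ι κ : Type*} [Fintype ι] [DecidableEq ι] [Fintype κ] [DecidableEq κ]
  {HA : ι → Type u} [∀ i, Fintype (HA i)] [∀ i, DecidableEq (HA i)]
  {HB : κ → Type u} [∀ j, Fintype (HB j)] [∀ j, DecidableEq (HB j)]
  {Z C : Type*} [Fintype Z] [Fintype C]

theorem tensorOp_glue {σ : Type*} [Fintype σ] [DecidableEq σ] {H : σ → Type u} (S : Finset σ)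
    (X : ∀ i : {i // i ∈ S}, Matrix (H i) (H i) ℂ) (Y : ∀ i : {i // i ∉ S}, Matrix (H i) (H i) ℂ)
    (a a' : ∀ i, H i) :
    tensorOp (glue (β := fun i => Matrix (H i) (H i) ℂ) S X Y) a a' =
      tensorOp X (inside S a) (inside S a') * tensorOp Y (outside S a) (outside S a') :=
  prod_glue S (β := fun i => Matrix (H i) (H i) ℂ) (γ := fun i => H i × H i)
    (fun _ x p => x p.1 p.2) X Y fun i => (a i, a' i)

/-- An effective process as a linear map. -/
def effLin (F : Z → C → Op HA →ₗ[ℂ] Op HB) {S : Finset ι} {T : Finset κ}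
    (l : Label HA HB Z C S T) :
    (Op fun i : {i // i ∈ S} => HA i) →ₗ[ℂ] Op fun j : {j // j ∈ T} => HB j where
  toFun := effMap F l
  map_add' X Y := by
    ext b b'
    simp only [effMap, Matrix.of_apply, Matrix.add_apply, ← Finset.sum_add_distrib]
    refine Finset.sum_congr rfl fun β _ => Finset.sum_congr rfl fun β' _ => ?_
    rw [← mul_add, ← Matrix.add_apply, ← map_add]
    simp only [add_mul]
    rfl
  map_smul' r X := by
    ext b b'
    simp only [effMap, Matrix.of_apply, Matrix.smul_apply, smul_eq_mul, RingHom.id_apply,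
      Finset.mul_sum]
    refine Finset.sum_congr rfl fun β _ => Finset.sum_congr rfl fun β' _ => ?_
    rw [mul_left_comm, ← smul_eq_mul r, ← Matrix.smul_apply, ← map_smul]
    simp only [mul_assoc]
    rfl

theorem effLin_apply (F : Z → C → Op HA →ₗ[ℂ] Op HB) {S : Finset ι} {T : Finset κ}
    (l : Label HA HB Z C S T) (X : Op fun i : {i // i ∈ S} => HA i) :
    effLin F l X = effMap F l X := rfl

/-- Probing the open wires of an effective process is the same as probing the whole process with the
operators glued to the states and effects of the label. This reduces statements about effective
processes to statements about `F` itself. -/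
theorem pair_effLin (F : Z → C → Op HA →ₗ[ℂ] Op HB) {S : Finset ι} {T : Finset κ}
    (l : Label HA HB Z C S T) (X : ∀ i : {i // i ∈ S}, Matrix (HA i) (HA i) ℂ)
    (D : ∀ j : {j // j ∈ T}, Matrix (HB j) (HB j) ℂ) :
    pair (effLin F l) X D = pair (F l.setting l.outcome)
      (glue (β := fun i => Matrix (HA i) (HA i) ℂ) S X fun i => (l.state i).1)
      (glue (β := fun j => Matrix (HB j) (HB j) ℂ) T D fun j => (l.effect j).1) := by
  have hX : (Matrix.of fun a a' => tensorOp X (inside S a) (inside S a') *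
      tensorOp (fun i => (l.state i).1) (outside S a) (outside S a')) =
      tensorOp (glue (β := fun i => Matrix (HA i) (HA i) ℂ) S X fun i => (l.state i).1) := by
    ext a a'
    rw [tensorOp_glue]
    rfl
  rw [pair, pair, effLin_apply]
  simp only [Matrix.trace, Matrix.diag_apply, Matrix.mul_apply, effMap, hX, Matrix.of_apply]
  rw [sum_glue T]
  simp only [sum_glue T (fun v => tensorOp _ _ v * _)]
  refine Finset.sum_congr rfl fun b' _ => ?_
  rw [Finset.sum_comm]
  refine Finset.sum_congr rfl fun b _ => ?_
  rw [Finset.mul_sum, Finset.sum_comm]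
  simp only [Finset.mul_sum]
  refine Finset.sum_congr rfl fun β _ => Finset.sum_congr rfl fun β' _ => ?_
  rw [tensorOp_glue]
  simp [mul_assoc]

/-- A parallel composition as a linear map. -/
def parLin (F : Z → C → Op HA →ₗ[ℂ] Op HB) {N : ℕ} (f : ι → Fin N) (g : κ → Fin N)
    (l : ∀ ν, Label HA HB Z C (block f ν) (block g ν)) : Op HA →ₗ[ℂ] Op HB where
  toFun := parMap F f g l
  map_add' X Y := by
    ext b b'
    simp [parMap, add_mul, Finset.sum_add_distrib]
  map_smul' r X := by
    ext b b'
    simp [parMap, Finset.mul_sum, mul_assoc]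

theorem parLin_apply (F : Z → C → Op HA →ₗ[ℂ] Op HB) {N : ℕ} (f : ι → Fin N) (g : κ → Fin N)
    (l : ∀ ν, Label HA HB Z C (block f ν) (block g ν)) (X : Op HA) :
    parLin F f g l X = parMap F f g l X := rfl

theorem parLin_single (F : Z → C → Op HA →ₗ[ℂ] Op HB) {N : ℕ} (f : ι → Fin N) (g : κ → Fin N)
    (l : ∀ ν, Label HA HB Z C (block f ν) (block g ν)) (a a' : ∀ i, HA i) (b b' : ∀ j, HB j) :
    parLin F f g l (Matrix.single a a' 1) b b' = ∏ ν, effLin F (l ν)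
      (Matrix.single (inside (block f ν) a) (inside (block f ν) a') 1)
      (inside (block g ν) b) (inside (block g ν) b') := by
  simp [parLin_apply, parMap, effLin_apply, Matrix.single_apply, ite_and]

theorem prod_tensorOp_block {σ : Type*} [Fintype σ] {H : σ → Type u} {N : ℕ} (f : σ → Fin N)
    (X : ∀ i, Matrix (H i) (H i) ℂ) (a a' : ∀ i, H i) :
    ∏ ν, tensorOp (inside (block f ν) X) (inside (block f ν) a) (inside (block f ν) a') =
      tensorOp X a a' :=
  prod_block f fun i => X i (a i) (a' i)

/-- A joint index is a family of indices, one for each block (`blockEquiv`), so the product of the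
blockwise sums expands into the full sum. -/
theorem pair_parLin (F : Z → C → Op HA →ₗ[ℂ] Op HB) {N : ℕ} (f : ι → Fin N) (g : κ → Fin N)
    (l : ∀ ν, Label HA HB Z C (block f ν) (block g ν)) (X : ∀ i, Matrix (HA i) (HA i) ℂ)
    (D : ∀ j, Matrix (HB j) (HB j) ℂ) :
    pair (parLin F f g l) X D =
      ∏ ν, pair (effLin F (l ν)) (inside (block f ν) X) (inside (block g ν) D) := by
  simp only [pair_eq_sum, Fintype.prod_sum]
  rw [← Equiv.sum_comp (blockEquiv f HA)]
  refine Finset.sum_congr rfl fun a _ => ?_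
  rw [← Equiv.sum_comp (blockEquiv f HA)]
  refine Finset.sum_congr rfl fun a' _ => ?_
  rw [← Equiv.sum_comp (blockEquiv g HB)]
  refine Finset.sum_congr rfl fun b _ => ?_
  rw [← Equiv.sum_comp (blockEquiv g HB)]
  refine Finset.sum_congr rfl fun b' _ => ?_
  rw [parLin_single, Finset.prod_mul_distrib, Finset.prod_mul_distrib,
    ← prod_tensorOp_block f X, ← prod_tensorOp_block g D]
  rfl

/-! ### Contractions of ontological representations -/

/-- Contraction of a conditional quasi-distribution with weights on all inputs and outputs. -/
def contract {ΛA : ι → Type*} {ΛB : κ → Type*} [∀ i, Fintype (ΛA i)] [∀ j, Fintype (ΛB j)]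
    (t : (∀ i, ΛA i) → (∀ j, ΛB j) → ℝ) (A : ∀ i, ΛA i → ℝ) (B : ∀ j, ΛB j → ℝ) : ℝ :=
  ∑ x, ∑ y, t x y * (∏ j, B j (y j)) * ∏ i, A i (x i)

open Classical in
/-- The point distribution. -/
def delta {Λ : Type*} (x : Λ) : Λ → ℝ := fun ξ => if x = ξ then 1 else 0

open Classical in
theorem prod_delta {σ : Type*} [Fintype σ] {Λ : σ → Type*} (x ξ : ∀ i, Λ i) :
    ∏ i, delta (x i) (ξ i) = if x = ξ then 1 else 0 := by
  simp only [delta, Finset.prod_ite_zero, funext_iff]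
  simp

/-- An open wire at a fixed ontic value is a wire contracted with a point distribution. This is the
ontological counterpart of `pair_effLin`. -/
theorem OntModel.eff_eq_contract (m : OntModel HA HB Z C) {S : Finset ι} {T : Finset κ}
    (l : Label HA HB Z C S T) (x : ∀ i : {i // i ∈ S}, m.ΛA i)
    (y : ∀ j : {j // j ∈ T}, m.ΛB j) :
    m.eff l x y = contract (m.trans l.setting l.outcome)
      (glue (β := fun i => m.ΛA i → ℝ) S (fun i => delta (x i)) fun i => m.prep i (l.state i))
      (glue (β := fun j => m.ΛB j → ℝ) T (fun j => delta (y j)) fun j => m.resp j (l.effect j)) := by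
  classical
  have hA : ∀ ξ : ∀ i, m.ΛA i, ∏ i, glue (β := fun i => m.ΛA i → ℝ) S (fun i => delta (x i))
      (fun i => m.prep i (l.state i)) i (ξ i) = (if x = inside S ξ then 1 else 0) *
        ∏ i : {i // i ∉ S}, m.prep i (l.state i) (outside S ξ i) := fun ξ => by
    rw [prod_glue S (β := fun i => m.ΛA i → ℝ) (γ := m.ΛA) (fun _ w a => w a), ← prod_delta]
    rfl
  have hB : ∀ η : ∀ j, m.ΛB j, ∏ j, glue (β := fun j => m.ΛB j → ℝ) T (fun j => delta (y j))
      (fun j => m.resp j (l.effect j)) j (η j) = (if y = inside T η then 1 else 0) *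
        ∏ j : {j // j ∉ T}, m.resp j (l.effect j) (outside T η j) := fun η => by
    rw [prod_glue T (β := fun j => m.ΛB j → ℝ) (γ := m.ΛB) (fun _ w a => w a), ← prod_delta]
    rfl
  simp only [contract, hA, hB, sum_glue S, sum_glue T, inside_glue, outside_glue]
  simp only [OntModel.eff, mul_ite, ite_mul, one_mul, zero_mul, mul_zero,
    Finset.sum_ite_irrel, Finset.sum_const_zero, Finset.sum_ite_eq, Finset.mem_univ, if_true]

end Effective

/-! ### Frames and the classical models they give -/

section Frames

variable {ι κ : Type*} [Fintype ι] [DecidableEq ι] [Fintype κ] [DecidableEq κ]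
  {HA : ι → Type u} [∀ i, Fintype (HA i)] [∀ i, DecidableEq (HA i)]
  {HB : κ → Type u} [∀ j, Fintype (HB j)] [∀ j, DecidableEq (HB j)]
  {Z C : Type*} [Fintype Z] [Fintype C]

/-- A decomposition of a process through finite classical systems: a measurement `e` and a family of
operators `G` on each input, a family of states (positive functionals on effects) `s` and a family
of operators `D` on each output, such that inserting `∑ x, e x (·) G x` on an input or the map with
adjoint `∑ y, s y (·) D y` on an output does not change the process, and such that the resulting
coefficients of the process form a conditional probability distribution. -/
structure Frame (F : Z → C → Op HA →ₗ[ℂ] Op HB) where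
  ΛA : ι → Type u
  ΛB : κ → Type u
  finA : ∀ i, Fintype (ΛA i)
  finB : ∀ j, Fintype (ΛB j)
  e : ∀ i, ΛA i → Matrix (HA i) (HA i) ℂ →ₗ[ℂ] ℂ
  G : ∀ i, ΛA i → Matrix (HA i) (HA i) ℂ
  s : ∀ j, ΛB j → Matrix (HB j) (HB j) ℂ →ₗ[ℂ] ℂ
  D : ∀ j, ΛB j → Matrix (HB j) (HB j) ℂ
  e_nonneg : ∀ i x P, P.PosSemidef → 0 ≤ e i x P
  e_sum : ∀ i X, ∑ x, e i x X = X.trace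
  s_nonneg : ∀ j y P, P.PosSemidef → 0 ≤ s j y P
  s_one : ∀ j y, s j y 1 = 1
  pair_nonneg : ∀ z c (x : ∀ i, ΛA i) (y : ∀ j, ΛB j),
    0 ≤ pair (F z c) (fun i => G i (x i)) (fun j => D j (y j))
  pair_sum : ∀ z (x : ∀ i, ΛA i),
    ∑ c, ∑ y : ∀ j, ΛB j, pair (F z c) (fun i => G i (x i)) (fun j => D j (y j)) = 1
  resolveA : ∀ z c X M i,
    ∑ x, e i x (X i) * pair (F z c) (Function.update X i (G i x)) M = pair (F z c) X M
  resolveB : ∀ z c X M j,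
    ∑ y, s j y (M j) * pair (F z c) X (Function.update M j (D j y)) = pair (F z c) X M

attribute [instance] Frame.finA Frame.finB

namespace Frame

variable {F : Z → C → Op HA →ₗ[ℂ] Op HB} (φ : Frame F)

/-- The one-slot resolutions of a frame may be applied in any selection of slots at once, since the
pairing is multilinear. -/
theorem pair_resolve (z : Z) (c : C) (X X' : ∀ i, Matrix (HA i) (HA i) ℂ)
    (M M' : ∀ j, Matrix (HB j) (HB j) ℂ)
    (hX : ∀ i, X' i = X i ∨ X' i = ∑ x, φ.e i x (X i) • φ.G i x)
    (hM : ∀ j, M' j = M j ∨ M' j = ∑ y, φ.s j y (M j) • φ.D j y) :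
    pair (F z c) X' M' = pair (F z c) X M := by
  have h1 : pairInput (F z c) M' X' = pairInput (F z c) M' X := by
    refine multilinear_resolve _ (fun i P => ∑ x, φ.e i x P • φ.G i x) (fun i m => ?_) X X' hX
    rw [MultilinearMap.map_update_sum]
    simp only [MultilinearMap.map_update_smul, pairInput_apply, smul_eq_mul]
    exact φ.resolveA z c m M' i
  have h2 : pairOutput (F z c) X M' = pairOutput (F z c) X M := by
    refine multilinear_resolve _ (fun j P => ∑ y, φ.s j y P • φ.D j y) (fun j m => ?_) M M' hM
    rw [MultilinearMap.map_update_sum]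
    simp only [MultilinearMap.map_update_smul, pairOutput_apply, smul_eq_mul]
    exact φ.resolveB z c X m j
  rw [← pairInput_apply, h1, pairInput_apply, ← pairOutput_apply, h2, pairOutput_apply]

end Frame

theorem pair_expand (A : Op HA →ₗ[ℂ] Op HB) {ΛA : ι → Type*} {ΛB : κ → Type*}
    [∀ i, Fintype (ΛA i)] [∀ j, Fintype (ΛB j)] (a : ∀ i, ΛA i → ℂ) (b : ∀ j, ΛB j → ℂ)
    (G : ∀ i, ΛA i → Matrix (HA i) (HA i) ℂ) (D : ∀ j, ΛB j → Matrix (HB j) (HB j) ℂ) :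
    pair A (fun i => ∑ x, a i x • G i x) (fun j => ∑ y, b j y • D j y) =
      ∑ x : ∀ i, ΛA i, ∑ y : ∀ j, ΛB j, pair A (fun i => G i (x i)) (fun j => D j (y j)) *
        (∏ j, b j (y j)) * ∏ i, a i (x i) := by
  rw [← pairInput_apply, multilinear_expand]
  refine Finset.sum_congr rfl fun x _ => ?_
  rw [pairInput_apply, ← pairOutput_apply, multilinear_expand, smul_eq_mul, Finset.mul_sum]
  refine Finset.sum_congr rfl fun y _ => ?_
  rw [pairOutput_apply, smul_eq_mul]
  ring

/-- The contraction of an ontological representation that is given by a pairing. -/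
theorem ofReal_contract (A : Op HA →ₗ[ℂ] Op HB) {ΛA : ι → Type*} {ΛB : κ → Type*}
    [∀ i, Fintype (ΛA i)] [∀ j, Fintype (ΛB j)] (t : (∀ i, ΛA i) → (∀ j, ΛB j) → ℝ)
    (a : ∀ i, ΛA i → ℝ) (b : ∀ j, ΛB j → ℝ)
    (G : ∀ i, ΛA i → Matrix (HA i) (HA i) ℂ) (D : ∀ j, ΛB j → Matrix (HB j) (HB j) ℂ)
    (h : ∀ x y, (t x y : ℂ) = pair A (fun i => G i (x i)) (fun j => D j (y j))) :
    (contract t a b : ℂ) =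
      pair A (fun i => ∑ x, (a i x : ℂ) • G i x) (fun j => ∑ y, (b j y : ℂ) • D j y) := by
  rw [pair_expand, contract]
  push_cast
  simp only [h]

theorem sum_delta_smul {Λ V : Type*} [Fintype Λ] [AddCommGroup V] [Module ℂ V] (x : Λ)
    (G : Λ → V) : ∑ ξ, (delta x ξ : ℂ) • G ξ = G x := by
  classical
  simp [delta, ite_smul]

namespace Frame

variable {F : Z → C → Op HA →ₗ[ℂ] Op HB} (φ : Frame F)

/-- The ontological representation given by a frame. -/
abbrev model : OntModel HA HB Z C where
  ΛA := φ.ΛA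
  ΛB := φ.ΛB
  finA := φ.finA
  finB := φ.finB
  prep i ρ x := (φ.e i x ρ.1).re
  resp j M y := (φ.s j y M.1).re
  trans z c x y := (pair (F z c) (fun i => φ.G i (x i)) (fun j => φ.D j (y j))).re

theorem ofReal_prep (i : ι) (ρ : DensityOp (HA i)) (x : φ.ΛA i) :
    (φ.model.prep i ρ x : ℂ) = φ.e i x ρ.1 :=
  ofReal_re_of_nonneg (φ.e_nonneg i x _ ρ.2.1)

theorem ofReal_resp (j : κ) (M : EffectOp (HB j)) (y : φ.ΛB j) :
    (φ.model.resp j M y : ℂ) = φ.s j y M.1 :=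
  ofReal_re_of_nonneg (φ.s_nonneg j y _ M.2.1)

theorem ofReal_trans (z : Z) (c : C) (x : ∀ i, φ.ΛA i) (y : ∀ j, φ.ΛB j) :
    (φ.model.trans z c x y : ℂ) = pair (F z c) (fun i => φ.G i (x i)) (fun j => φ.D j (y j)) :=
  ofReal_re_of_nonneg (φ.pair_nonneg z c x y)

/-- Contracting the coefficients with weights puts a weighted sum of frame operators into every
slot. On an open wire the point distribution leaves a single `G` or `D`; on a closed wire the sum is
the resolution of the state or effect, which `pair_resolve` turns back into that state or effect. -/
theorem ofReal_eff {S : Finset ι} {T : Finset κ} (l : Label HA HB Z C S T)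
    (x : ∀ i : {i // i ∈ S}, φ.ΛA i) (y : ∀ j : {j // j ∈ T}, φ.ΛB j) :
    (φ.model.eff l x y : ℂ) =
      pair (effLin F l) (fun i => φ.G i (x i)) (fun j => φ.D j (y j)) := by
  rw [OntModel.eff_eq_contract, ofReal_contract (F l.setting l.outcome) _ _ _ φ.G φ.D
    (φ.ofReal_trans _ _), pair_effLin]
  refine φ.pair_resolve _ _ _ _ _ _ (fun i => ?_) fun j => ?_
  · by_cases h : i ∈ S
    · left
      simp only [glue_of_mem _ _ _ h]
      exact sum_delta_smul (x ⟨i, h⟩) (φ.G i)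
    · right
      simp only [glue_of_notMem _ _ _ h]
      exact Finset.sum_congr rfl fun ξ _ => by rw [φ.ofReal_prep]
  · by_cases h : j ∈ T
    · left
      simp only [glue_of_mem _ _ _ h]
      exact sum_delta_smul (y ⟨j, h⟩) (φ.D j)
    · right
      simp only [glue_of_notMem _ _ _ h]
      exact Finset.sum_congr rfl fun ξ _ => by rw [φ.ofReal_resp]

theorem ofReal_par {N : ℕ} (f : ι → Fin N) (g : κ → Fin N)
    (l : ∀ ν, Label HA HB Z C (block f ν) (block g ν)) (x : ∀ i, φ.ΛA i) (y : ∀ j, φ.ΛB j) :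
    (φ.model.par f g l x y : ℂ) =
      pair (parLin F f g l) (fun i => φ.G i (x i)) (fun j => φ.D j (y j)) := by
  rw [pair_parLin, OntModel.par, Complex.ofReal_prod]
  exact Finset.prod_congr rfl fun ν _ => φ.ofReal_eff (l ν) _ _

/-- Each component of the model is a fixed linear functional applied to the quantum object: `e`,
`s`, or the pairing with the frame operators. Every linear relation among the objects is therefore
inherited. -/
theorem explains_model : φ.model.Explains F where
  prep_nonneg i ρ x := (Complex.le_def.1 (φ.e_nonneg i x _ ρ.2.1)).1
  prep_sum i ρ := by
    refine Complex.ofReal_injective ?_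
    rw [Complex.ofReal_sum]
    refine (Finset.sum_congr rfl fun x _ => φ.ofReal_prep i ρ x).trans ?_
    rw [φ.e_sum, ρ.2.2, Complex.ofReal_one]
  resp_nonneg j M y := (Complex.le_def.1 (φ.s_nonneg j y _ M.2.1)).1
  resp_le_one j M y := by
    have := φ.s_nonneg j y _ M.2.2
    rw [map_sub, φ.s_one] at this
    simpa using (Complex.le_def.1 this).1
  resp_sum j n M hM y := by
    have : ∑ b, φ.s j y (M b).1 = 1 := by rw [← map_sum, hM, φ.s_one]
    refine Complex.ofReal_injective ?_
    rw [Complex.ofReal_sum, Complex.ofReal_one, ← this]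
    exact Finset.sum_congr rfl fun b _ => φ.ofReal_resp j (M b) y
  trans_nonneg z c x y := (Complex.le_def.1 (φ.pair_nonneg z c x y)).1
  trans_sum z x := by
    refine Complex.ofReal_injective ?_
    rw [Complex.ofReal_sum, Complex.ofReal_one, ← φ.pair_sum z x]
    refine Finset.sum_congr rfl fun c _ => ?_
    rw [Complex.ofReal_sum]
    exact Finset.sum_congr rfl fun y _ => φ.ofReal_trans z c x y
  reproduces ρ M z c := by
    change pair (F z c) _ _ = ((contract (φ.model.trans z c) (fun i => φ.model.prep i (ρ i))
      fun j => φ.model.resp j (M j) : ℝ) : ℂ)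
    rw [ofReal_contract (F z c) _ _ _ φ.G φ.D (φ.ofReal_trans _ _)]
    refine (φ.pair_resolve _ _ _ _ _ _ (fun i => .inr ?_) fun j => .inr ?_).symm
    · exact Finset.sum_congr rfl fun ξ _ => by rw [φ.ofReal_prep]
    · exact Finset.sum_congr rfl fun ξ _ => by rw [φ.ofReal_resp]
  prep_linear i α h x := by
    have := congrArg (φ.e i x) h
    rw [map_zero, Finsupp.sum, map_sum] at this
    rw [Finsupp.sum, ← Complex.ofReal_eq_zero, Complex.ofReal_sum, ← this]
    refine Finset.sum_congr rfl fun ρ _ => ?_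
    rw [Complex.ofReal_mul, φ.ofReal_prep, ← Complex.coe_smul, map_smul, smul_eq_mul]
  resp_linear j α h y := by
    have := congrArg (φ.s j y) h
    rw [map_zero, Finsupp.sum, map_sum] at this
    rw [Finsupp.sum, ← Complex.ofReal_eq_zero, Complex.ofReal_sum, ← this]
    refine Finset.sum_congr rfl fun ρ _ => ?_
    rw [Complex.ofReal_mul, φ.ofReal_resp, ← Complex.coe_smul, map_smul, smul_eq_mul]
  seq_linear S T α h x y := by
    -- The hypothesis, stated operator by operator, is a relation between linear maps, to which the
    -- linear functional `pairMap` can be applied.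
    have h0 : (α.sum fun l r => (r : ℂ) • effLin F l) = 0 := by
      refine LinearMap.ext fun X => ?_
      have := h X
      simp only [Finsupp.sum, LinearMap.sum_apply, LinearMap.smul_apply, effLin_apply,
        LinearMap.zero_apply, Complex.coe_smul] at this ⊢
      exact this
    have := congrArg (pairMap (fun i : {i // i ∈ S} => φ.G i (x i))
      (fun j : {j // j ∈ T} => φ.D j (y j))) h0
    rw [map_zero, Finsupp.sum, map_sum] at this
    rw [Finsupp.sum, ← Complex.ofReal_eq_zero, Complex.ofReal_sum, ← this]
    refine Finset.sum_congr rfl fun l _ => ?_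
    rw [Complex.ofReal_mul, φ.ofReal_eff, map_smul, smul_eq_mul, pairMap_apply]
  par_linear N f g α₀ α h x y := by
    have h0 : (∑ z, ∑ c, (α₀ z c : ℂ) • F z c) + (α.sum fun l r => (r : ℂ) • parLin F f g l) = 0 := by
      refine LinearMap.ext fun X => ?_
      have := h X
      simp only [Finsupp.sum, LinearMap.sum_apply, LinearMap.smul_apply, parLin_apply,
        LinearMap.zero_apply, Complex.coe_smul, LinearMap.add_apply] at this ⊢
      exact this
    have := congrArg (pairMap (fun i => φ.G i (x i)) (fun j => φ.D j (y j))) h0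
    rw [map_zero, Finsupp.sum, map_add, map_sum, map_sum] at this
    rw [Finsupp.sum, ← Complex.ofReal_eq_zero, Complex.ofReal_add, Complex.ofReal_sum,
      Complex.ofReal_sum, ← this]
    congr 1
    · refine Finset.sum_congr rfl fun z _ => ?_
      rw [map_sum, Complex.ofReal_sum]
      refine Finset.sum_congr rfl fun c _ => ?_
      rw [Complex.ofReal_mul, φ.ofReal_trans, map_smul, smul_eq_mul, pairMap_apply]
    · refine Finset.sum_congr rfl fun l _ => ?_
      rw [Complex.ofReal_mul, φ.ofReal_par, map_smul, smul_eq_mul, pairMap_apply]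

theorem isClassical (φ : Frame F) : IsClassical F := ⟨φ.model, φ.explains_model⟩

end Frame

end Frames

/-! ### Linear extension -/

/-- The assignment `v i ↦ r i` extends linearly exactly when `r` respects all complex relations
among the `v i`, whereas `hr` covers only the real ones. By `hre`, the real parts of the
coefficients of a relation form a relation too. -/
theorem exists_functional {I V : Type*} [AddCommGroup V] [Module ℂ V] (v : I → V) (r : I → ℝ)
    (hre : ∀ β : I →₀ ℂ, (β.sum fun i b => b • v i) = 0 → (β.sum fun i b => (b.re : ℂ) • v i) = 0)
    (hr : ∀ α : I →₀ ℝ, (α.sum fun i a => (a : ℂ) • v i) = 0 → (α.sum fun i a => a * r i) = 0) :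
    ∃ g : V →ₗ[ℂ] ℂ, ∀ i, g (v i) = r i := by
  have key : ∀ β : I →₀ ℂ, (β.sum fun i b => b • v i) = 0 → (β.sum fun i b => b.re * r i) = 0 := by
    intro β hβ
    have := hr (β.mapRange Complex.re Complex.zero_re) (by
      rw [Finsupp.sum_mapRange_index (by simp)]
      exact hre β hβ)
    rwa [Finsupp.sum_mapRange_index (by simp)] at this
  have hmem : Finsupp.linearCombination ℂ (fun i => (r i : ℂ)) ∈
      LinearMap.range (Finsupp.linearCombination ℂ v).dualMap := by
    rw [LinearMap.range_dualMap_eq_dualAnnihilator_ker, Submodule.mem_dualAnnihilator]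
    intro β hβ
    rw [LinearMap.mem_ker, Finsupp.linearCombination_apply] at hβ
    rw [Finsupp.linearCombination_apply]
    have h1 := key β hβ
    -- The real parts of `i β` are the negative imaginary parts of `β`, so this disposes of the
    -- imaginary part.
    have h2 := key (Complex.I • β) (by
      rw [Finsupp.sum_smul_index (by simp)]
      simp only [mul_smul]
      rw [← Finsupp.smul_sum, hβ, smul_zero])
    rw [Finsupp.sum_smul_index (by simp)] at h2
    refine Complex.ext ?_ ?_
    · simpa [Finsupp.sum] using h1
    · simpa [Finsupp.sum] using h2
  obtain ⟨g, hg⟩ := hmem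
  refine ⟨g, fun i => ?_⟩
  simpa using congrArg (fun f => f (Finsupp.single i 1)) hg

/-- Taking adjoints of a relation among Hermitian matrices conjugates its coefficients; averaging
the two relations leaves the real parts. -/
theorem exists_functional_of_isHermitian {n : Type*} [Fintype n] [DecidableEq n]
    {p : Matrix n n ℂ → Prop} (hp : ∀ M, p M → M.IsHermitian) (r : {M // p M} → ℝ)
    (hr : ∀ α : {M // p M} →₀ ℝ, (α.sum fun M a => a • M.1) = 0 →
      (α.sum fun M a => a * r M) = 0) :
    ∃ g : Matrix n n ℂ →ₗ[ℂ] ℂ, ∀ M : {M // p M}, g M.1 = r M := by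
  refine exists_functional (fun M : {M // p M} => M.1) r (fun β hβ => ?_) fun α hα => ?_
  · have h := congrArg Matrix.conjTranspose hβ
    rw [Finsupp.sum, Matrix.conjTranspose_sum, Matrix.conjTranspose_zero] at h
    simp only [Matrix.conjTranspose_smul, (hp _ (Subtype.prop _)).eq] at h
    have h2 : (β.sum fun M b => (b.re : ℂ) • M.1) = (2⁻¹ : ℂ) • (∑ M ∈ β.support, β M • M.1 +
        ∑ M ∈ β.support, star (β M) • M.1) := by
      rw [← Finset.sum_add_distrib, Finset.smul_sum, Finsupp.sum]
      refine Finset.sum_congr rfl fun M _ => ?_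
      rw [← add_smul, smul_smul]
      congr 1
      have := Complex.add_conj (β M)
      rw [Complex.star_def, this]
      simp
    rw [h2, h]
    rw [Finsupp.sum] at hβ
    rw [hβ]
    simp
  · exact hr α (by simpa only [Complex.coe_smul] using hα)

/-- Evaluation at suitable points interpolates every member of a family of functionals by finitely
many members. -/
theorem exists_interpolation {I V : Type*} [AddCommGroup V] [Module ℂ V] [FiniteDimensional ℂ V]
    (v : I → Module.Dual ℂ V) :
    ∃ (n : ℕ) (l : Fin n → I) (X : Fin n → V), ∀ t Y, v t (∑ a, v (l a) Y • X a) = v t Y := by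
  classical
  obtain ⟨κ, a, -, hspan, hli⟩ := exists_linearIndependent' ℂ v
  have : Finite κ := hli.finite
  obtain ⟨n, ⟨en⟩⟩ := Finite.exists_equiv_fin κ
  have hli' : LinearIndependent ℂ (v ∘ a ∘ en.symm) := hli.comp _ en.symm.injective
  have hspan' : Submodule.span ℂ (Set.range (v ∘ a ∘ en.symm)) =
      Submodule.span ℂ (Set.range v) := by
    rw [← hspan, ← Function.comp_assoc, Set.range_comp, Set.range_eq_univ.2 en.symm.surjective,
      Set.image_univ]
  -- A maximal independent subfamily has coordinate functionals on its span. Extended to the whole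
  -- dual, they are evaluations at points by reflexivity, and these points serve as `X`.
  have hg : ∀ b, ∃ g : Module.Dual ℂ (Module.Dual ℂ V),
      ∀ b', g (v (a (en.symm b'))) = if b' = b then 1 else 0 := by
    intro b
    obtain ⟨g, hg⟩ := LinearMap.exists_extend ((Module.Basis.span hli').coord b)
    refine ⟨g, fun b' => ?_⟩
    have h1 := congrArg (fun f => f (Module.Basis.span hli' b')) hg
    rw [LinearMap.comp_apply, Submodule.subtype_apply, Module.Basis.coord_apply,
      Module.Basis.repr_self, Finsupp.single_apply, Module.Basis.span_apply] at h1
    exact h1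
  choose g hg using hg
  refine ⟨n, a ∘ en.symm, fun b => (Module.evalEquiv ℂ V).symm (g b), fun t Y => ?_⟩
  have ht : v t ∈ Submodule.span ℂ (Set.range (v ∘ a ∘ en.symm)) := by
    rw [hspan']
    exact Submodule.subset_span ⟨t, rfl⟩
  obtain ⟨c, hc⟩ := (Submodule.mem_span_range_iff_exists_fun ℂ).1 ht
  have hX : ∀ b, v t ((Module.evalEquiv ℂ V).symm (g b)) = c b := by
    intro b
    rw [Module.apply_evalEquiv_symm_apply, ← hc]
    simp [hg]
  simp only [map_sum, map_smul, hX]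
  rw [← hc]
  simp [mul_comm]

theorem multilinear_resolve_of_span {R ι W : Type*} {V : ι → Type*} [CommRing R] [Fintype ι]
    [DecidableEq ι] [∀ i, AddCommGroup (V i)] [∀ i, Module R (V i)] [AddCommGroup W] [Module R W]
    (f : MultilinearMap R V W) {S : ∀ i, Set (V i)} (hS : ∀ i, Submodule.span R (S i) = ⊤) (i : ι)
    (π : V i →ₗ[R] V i)
    (h : ∀ m, (∀ i, m i ∈ S i) → f (Function.update m i (π (m i))) = f m) (m : ∀ i, V i) :
    f (Function.update m i (π (m i))) = f m := by
  have hg : ∀ m : ∀ i, V i, f.compLinearMap (Function.update (fun _ => LinearMap.id) i π) m =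
      f (Function.update m i (π (m i))) := by
    intro m
    rw [MultilinearMap.compLinearMap_apply]
    congr 1
    funext k
    by_cases hk : k = i
    · subst hk; simp
    · simp [hk]
  rw [← hg]
  exact congrArg (fun F => F m)
    (multilinear_eq_of_span (f := f.compLinearMap (Function.update (fun _ => LinearMap.id) i π))
      (g := f) hS fun m hm => by rw [hg]; exact h m hm)

/-! ### Resolutions and contractions in a single slot -/

section Extract

variable {ι κ : Type*} [Fintype ι] [DecidableEq ι] [Fintype κ] [DecidableEq κ]
  {HA : ι → Type u} [∀ i, Fintype (HA i)] [∀ i, DecidableEq (HA i)]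
  {HB : κ → Type u} [∀ j, Fintype (HB j)] [∀ j, DecidableEq (HB j)]
  {Z C : Type*} [Fintype Z] [Fintype C]

/-- For pure arguments the pairing is a probability that a model reproduces; multilinearity carries
the resolution over to all operators. -/
theorem pair_resolve_input (A : Op HA →ₗ[ℂ] Op HB) (i : ι)
    (π : Matrix (HA i) (HA i) ℂ →ₗ[ℂ] Matrix (HA i) (HA i) ℂ)
    (h : ∀ X M, (∀ i, IsPure (X i)) → (∀ j, IsPure (M j)) →
      pair A (Function.update X i (π (X i))) M = pair A X M)
    (X : ∀ i, Matrix (HA i) (HA i) ℂ) (M : ∀ j, Matrix (HB j) (HB j) ℂ) :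
    pair A (Function.update X i (π (X i))) M = pair A X M := by
  have h1 : ∀ X, (∀ i, IsPure (X i)) →
      pairOutput A (Function.update X i (π (X i))) = pairOutput A X := fun X hX =>
    multilinear_eq_of_span (fun j => span_pure) fun M hM => by
      simpa only [pairOutput_apply] using h X M hX hM
  have h2 := multilinear_resolve_of_span (pairInput A M) (fun i => span_pure) i π fun X hX => by
    simpa only [pairOutput_apply, pairInput_apply] using congrArg (fun f => f M) (h1 X hX)
  simpa only [pairInput_apply] using h2 X

theorem pair_resolve_output (A : Op HA →ₗ[ℂ] Op HB) (j : κ)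
    (π : Matrix (HB j) (HB j) ℂ →ₗ[ℂ] Matrix (HB j) (HB j) ℂ)
    (h : ∀ X M, (∀ i, IsPure (X i)) → (∀ j, IsPure (M j)) →
      pair A X (Function.update M j (π (M j))) = pair A X M)
    (X : ∀ i, Matrix (HA i) (HA i) ℂ) (M : ∀ j, Matrix (HB j) (HB j) ℂ) :
    pair A X (Function.update M j (π (M j))) = pair A X M := by
  have h1 : ∀ M, (∀ j, IsPure (M j)) →
      pairInput A (Function.update M j (π (M j))) = pairInput A M := fun M hM =>
    multilinear_eq_of_span (fun i => span_pure) fun X hX => by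
      simpa only [pairInput_apply] using h X M hX hM
  have h2 := multilinear_resolve_of_span (pairOutput A X) (fun j => span_pure) j π fun M hM => by
    simpa only [pairOutput_apply, pairInput_apply] using congrArg (fun f => f X) (h1 M hM)
  simpa only [pairOutput_apply] using h2 M

/-! ### Contractions -/

theorem sum_mul_prod_update_delta {σ : Type*} [Fintype σ] [DecidableEq σ] {Λ : σ → Type*}
    [∀ i, Fintype (Λ i)] (A : ∀ i, Λ i → ℝ) (i : σ) (ξ : ∀ i, Λ i) :
    ∑ x, A i x * ∏ k, Function.update A i (delta x) k (ξ k) = ∏ k, A k (ξ k) := by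
  classical
  have : ∀ x, ∏ k, Function.update A i (delta x) k (ξ k) =
      delta x (ξ i) * ∏ k ∈ Finset.univ.erase i, A k (ξ k) := by
    intro x
    rw [← Finset.mul_prod_erase _ _ (Finset.mem_univ i)]
    congr 1
    · simp
    · exact Finset.prod_congr rfl fun k hk => by simp [Finset.ne_of_mem_erase hk]
  simp only [this, delta, ite_mul, one_mul, zero_mul, mul_ite, mul_zero, Finset.sum_ite_eq',
    Finset.mem_univ, if_true]
  rw [← Finset.mul_prod_erase _ _ (Finset.mem_univ i)]

/-- A distribution is the mixture of point distributions with itself as weights. This is the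
classical identity behind `resolveA`. -/
theorem contract_update_input {ΛA : ι → Type*} {ΛB : κ → Type*} [∀ i, Fintype (ΛA i)]
    [∀ j, Fintype (ΛB j)] (t : (∀ i, ΛA i) → (∀ j, ΛB j) → ℝ) (A : ∀ i, ΛA i → ℝ)
    (B : ∀ j, ΛB j → ℝ) (i : ι) :
    ∑ x, A i x * contract t (Function.update A i (delta x)) B = contract t A B := by
  simp only [contract, Finset.mul_sum]
  rw [Finset.sum_comm]
  refine Finset.sum_congr rfl fun ξ _ => ?_
  rw [Finset.sum_comm]
  refine Finset.sum_congr rfl fun η _ => ?_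
  simp only [mul_left_comm (A i _), ← Finset.mul_sum]
  rw [sum_mul_prod_update_delta]

theorem contract_update_output {ΛA : ι → Type*} {ΛB : κ → Type*} [∀ i, Fintype (ΛA i)]
    [∀ j, Fintype (ΛB j)] (t : (∀ i, ΛA i) → (∀ j, ΛB j) → ℝ) (A : ∀ i, ΛA i → ℝ)
    (B : ∀ j, ΛB j → ℝ) (j : κ) :
    ∑ y, B j y * contract t A (Function.update B j (delta y)) = contract t A B := by
  simp only [contract, Finset.mul_sum]
  rw [Finset.sum_comm]
  refine Finset.sum_congr rfl fun ξ _ => ?_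
  rw [Finset.sum_comm]
  refine Finset.sum_congr rfl fun η _ => ?_
  simp only [mul_right_comm _ _ (∏ i, A i (ξ i)), mul_left_comm (B j _), ← Finset.mul_sum]
  rw [sum_mul_prod_update_delta]

/-! ### Local labels -/

variable (HA HB Z C) in
/-- A state on every input, an effect on every output, a setting and an outcome. -/
structure Circuit where
  state : ∀ i, DensityOp (HA i)
  effect : ∀ j, EffectOp (HB j)
  setting : Z
  outcome : C

/-- The label of an effective process that is a part of a circuit. -/
def Circuit.label (t : Circuit HA HB Z C) (S : Finset ι) (T : Finset κ) : Label HA HB Z C S T where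
  state := outside S t.state
  effect := outside T t.effect
  setting := t.setting
  outcome := t.outcome

/-- The functional on operators on input `i` that results from replacing the state on that input. -/
def Circuit.inputFunctional (F : Z → C → Op HA →ₗ[ℂ] Op HB) (t : Circuit HA HB Z C) (i : ι) :
    Module.Dual ℂ (Matrix (HA i) (HA i) ℂ) :=
  (pairInput (F t.setting t.outcome) fun j => (t.effect j).1).toLinearMap (fun i => (t.state i).1) i

/-- The functional on operators on output `j` that results from replacing the effect on it. -/
def Circuit.outputFunctional (F : Z → C → Op HA →ₗ[ℂ] Op HB) (t : Circuit HA HB Z C) (j : κ) :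
    Module.Dual ℂ (Matrix (HB j) (HB j) ℂ) :=
  (pairOutput (F t.setting t.outcome) fun i => (t.state i).1).toLinearMap
    (fun j => (t.effect j).1) j

theorem Circuit.inputFunctional_apply (F : Z → C → Op HA →ₗ[ℂ] Op HB) (t : Circuit HA HB Z C)
    (i : ι) (X : Matrix (HA i) (HA i) ℂ) : t.inputFunctional F i X =
      pair (F t.setting t.outcome) (Function.update (fun i => (t.state i).1) i X)
        fun j => (t.effect j).1 := by
  simp [inputFunctional, pairInput_apply]

theorem Circuit.outputFunctional_apply (F : Z → C → Op HA →ₗ[ℂ] Op HB) (t : Circuit HA HB Z C)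
    (j : κ) (X : Matrix (HB j) (HB j) ℂ) : t.outputFunctional F j X =
      pair (F t.setting t.outcome) (fun i => (t.state i).1)
        (Function.update (fun j => (t.effect j).1) j X) := by
  simp [outputFunctional, pairOutput_apply]

namespace OntModel

variable (m : OntModel HA HB Z C)

/-- The ontological counterpart of `Circuit.inputFunctional`. -/
def inputWeight (t : Circuit HA HB Z C) (i : ι) (x : m.ΛA i) : ℝ :=
  contract (m.trans t.setting t.outcome)
    (Function.update (fun i => m.prep i (t.state i)) i (delta x)) fun j => m.resp j (t.effect j)

/-- The ontological counterpart of `Circuit.outputFunctional`. -/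
def outputWeight (t : Circuit HA HB Z C) (j : κ) (y : m.ΛB j) : ℝ :=
  contract (m.trans t.setting t.outcome) (fun i => m.prep i (t.state i))
    (Function.update (fun j => m.resp j (t.effect j)) j (delta y))

end OntModel

theorem glue_eq_update {σ : Type*} [DecidableEq σ] {β : σ → Type*} {S : Finset σ} {i : σ}
    (hS : ∀ k, k ∈ S ↔ k = i) (v : ∀ i : {i // i ∈ S}, β i) (w : ∀ i, β i) :
    glue S v (outside S w) = Function.update w i (v ⟨i, (hS i).2 rfl⟩) := by
  funext k
  by_cases h : k ∈ S
  · obtain rfl := (hS k).1 h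
    rw [glue_of_mem _ _ _ h, Function.update_self]
  · rw [glue_of_notMem _ _ _ h, Function.update_of_ne fun hk => h ((hS k).2 hk)]
    rfl

theorem glue_eq_right {σ : Type*} [DecidableEq σ] {β : σ → Type*} {S : Finset σ}
    (hS : ∀ k, k ∉ S) (v : ∀ i : {i // i ∈ S}, β i) (w : ∀ i, β i) :
    glue S v (outside S w) = w := by
  funext k
  rw [glue_of_notMem _ _ _ (hS k)]
  rfl

section
variable {F : Z → C → Op HA →ₗ[ℂ] Op HB} {S : Finset ι} {T : Finset κ}

/-- Contracting everything except one input. -/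
theorem pair_effLin_label_input (t : Circuit HA HB Z C) (i : ι) (hS : ∀ k, k ∈ S ↔ k = i)
    (hT : ∀ j, j ∉ T) (X : ∀ i : {i // i ∈ S}, Matrix (HA i) (HA i) ℂ)
    (D : ∀ j : {j // j ∈ T}, Matrix (HB j) (HB j) ℂ) :
    pair (effLin F (t.label S T)) X D = t.inputFunctional F i (X ⟨i, (hS i).2 rfl⟩) := by
  rw [pair_effLin, t.inputFunctional_apply]
  congr 1
  · exact glue_eq_update (β := fun i => Matrix (HA i) (HA i) ℂ) hS X fun i => (t.state i).1
  · exact glue_eq_right (β := fun j => Matrix (HB j) (HB j) ℂ) hT D fun j => (t.effect j).1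

/-- Contracting everything except one output. -/
theorem pair_effLin_label_output (t : Circuit HA HB Z C) (j : κ) (hS : ∀ i, i ∉ S)
    (hT : ∀ k, k ∈ T ↔ k = j) (X : ∀ i : {i // i ∈ S}, Matrix (HA i) (HA i) ℂ)
    (D : ∀ j : {j // j ∈ T}, Matrix (HB j) (HB j) ℂ) :
    pair (effLin F (t.label S T)) X D = t.outputFunctional F j (D ⟨j, (hT j).2 rfl⟩) := by
  rw [pair_effLin, t.outputFunctional_apply]
  congr 1
  · exact glue_eq_right (β := fun i => Matrix (HA i) (HA i) ℂ) hS X fun i => (t.state i).1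
  · exact glue_eq_update (β := fun j => Matrix (HB j) (HB j) ℂ) hT D fun j => (t.effect j).1

theorem eff_label_input (m : OntModel HA HB Z C) (t : Circuit HA HB Z C) (i : ι)
    (hS : ∀ k, k ∈ S ↔ k = i) (hT : ∀ j, j ∉ T) (x : ∀ i : {i // i ∈ S}, m.ΛA i)
    (y : ∀ j : {j // j ∈ T}, m.ΛB j) :
    m.eff (t.label S T) x y = m.inputWeight t i (x ⟨i, (hS i).2 rfl⟩) := by
  rw [m.eff_eq_contract, OntModel.inputWeight]
  congr 1
  · exact glue_eq_update (β := fun i => m.ΛA i → ℝ) hS (fun i => delta (x i))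
      fun i => m.prep i (t.state i)
  · exact glue_eq_right (β := fun j => m.ΛB j → ℝ) hT (fun j => delta (y j))
      fun j => m.resp j (t.effect j)

theorem eff_label_output (m : OntModel HA HB Z C) (t : Circuit HA HB Z C) (j : κ)
    (hS : ∀ i, i ∉ S) (hT : ∀ k, k ∈ T ↔ k = j) (x : ∀ i : {i // i ∈ S}, m.ΛA i)
    (y : ∀ j : {j // j ∈ T}, m.ΛB j) :
    m.eff (t.label S T) x y = m.outputWeight t j (y ⟨j, (hT j).2 rfl⟩) := by
  rw [m.eff_eq_contract, OntModel.outputWeight]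
  congr 1
  · exact glue_eq_right (β := fun i => m.ΛA i → ℝ) hS (fun i => delta (x i))
      fun i => m.prep i (t.state i)
  · exact glue_eq_update (β := fun j => m.ΛB j → ℝ) hT (fun j => delta (y j))
      fun j => m.resp j (t.effect j)

end

end Extract

/-! ### From a classical model to a frame -/

section Extract

variable {ι : Type v} {κ : Type w} [Fintype ι] [DecidableEq ι] [Fintype κ] [DecidableEq κ]
  {HA : ι → Type u} [∀ i, Fintype (HA i)] [∀ i, DecidableEq (HA i)]
  {HB : κ → Type u} [∀ j, Fintype (HB j)] [∀ j, DecidableEq (HB j)]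
  {Z C : Type*} [Fintype Z] [Fintype C]

/-- The density operator of a pure state. -/
def IsPure.density {n : Type*} [Fintype n] {P : Matrix n n ℂ} (h : IsPure P) : DensityOp n :=
  ⟨P, h.1⟩

/-- A pure state as an effect. -/
def IsPure.effect {n : Type*} [Fintype n] [DecidableEq n] {P : Matrix n n ℂ} (h : IsPure P) :
    EffectOp n :=
  ⟨P, h.isEffect⟩

/-- The circuit of pure states and pure effects. -/
def pureCircuit {X : ∀ i, Matrix (HA i) (HA i) ℂ} {M : ∀ j, Matrix (HB j) (HB j) ℂ}
    (hX : ∀ i, IsPure (X i)) (hM : ∀ j, IsPure (M j)) (z : Z) (c : C) : Circuit HA HB Z C where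
  state i := (hX i).density
  effect j := (hM j).effect
  setting := z
  outcome := c

theorem inputFunctional_pureCircuit (F : Z → C → Op HA →ₗ[ℂ] Op HB)
    {X : ∀ i, Matrix (HA i) (HA i) ℂ} {M : ∀ j, Matrix (HB j) (HB j) ℂ}
    (hX : ∀ i, IsPure (X i)) (hM : ∀ j, IsPure (M j)) (z : Z) (c : C) (i : ι)
    (Y : Matrix (HA i) (HA i) ℂ) :
    (pureCircuit hX hM z c).inputFunctional F i Y = pair (F z c) (Function.update X i Y) M :=
  Circuit.inputFunctional_apply _ _ _ _

theorem outputFunctional_pureCircuit (F : Z → C → Op HA →ₗ[ℂ] Op HB)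
    {X : ∀ i, Matrix (HA i) (HA i) ℂ} {M : ∀ j, Matrix (HB j) (HB j) ℂ}
    (hX : ∀ i, IsPure (X i)) (hM : ∀ j, IsPure (M j)) (z : Z) (c : C) (j : κ)
    (Y : Matrix (HB j) (HB j) ℂ) :
    (pureCircuit hX hM z c).outputFunctional F j Y = pair (F z c) X (Function.update M j Y) :=
  Circuit.outputFunctional_apply _ _ _ _

namespace OntModel.Explains

variable {F : Z → C → Op HA →ₗ[ℂ] Op HB} {m : OntModel HA HB Z C}

theorem pair_circuit (hm : m.Explains F) (t : Circuit HA HB Z C) :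
    pair (F t.setting t.outcome) (fun i => (t.state i).1) (fun j => (t.effect j).1) =
      (contract (m.trans t.setting t.outcome) (fun i => m.prep i (t.state i))
        fun j => m.resp j (t.effect j) : ℝ) :=
  hm.reproduces t.state t.effect t.setting t.outcome

/-- The value is that of the circuit with `ρ` inserted, a real number by the model. Reality on a
spanning set is what allows real parts of coefficients to be taken in `re_sum_eq_zero`. -/
theorem exists_real_inputFunctional (hm : m.Explains F) (t : Circuit HA HB Z C) (i : ι)
    (ρ : DensityOp (HA i)) : ∃ r : ℝ, t.inputFunctional F i ρ.1 = r := by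
  have := hm.pair_circuit { t with state := Function.update t.state i ρ }
  refine ⟨_, Eq.trans ?_ this⟩
  rw [t.inputFunctional_apply]
  congr 1
  exact funext fun k => (Function.apply_update (fun _ ρ => Subtype.val ρ) t.state i ρ k).symm

theorem exists_real_outputFunctional (hm : m.Explains F) (t : Circuit HA HB Z C) (j : κ)
    (M : EffectOp (HB j)) : ∃ r : ℝ, t.outputFunctional F j M.1 = r := by
  have := hm.pair_circuit { t with effect := Function.update t.effect j M }
  refine ⟨_, Eq.trans ?_ this⟩
  rw [t.outputFunctional_apply]
  congr 1
  exact funext fun k => (Function.apply_update (fun _ M => Subtype.val M) t.effect j M k).symm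

theorem eff_linear (hm : m.Explains F) (S : Finset ι) (T : Finset κ) (α : Circuit HA HB Z C →₀ ℝ)
    (h : (α.sum fun t a => (a : ℂ) • effLin F (t.label S T)) = 0)
    (x : ∀ i : {i // i ∈ S}, m.ΛA i) (y : ∀ j : {j // j ∈ T}, m.ΛB j) :
    (α.sum fun t a => a * m.eff (t.label S T) x y) = 0 := by
  have := hm.seq_linear S T (α.mapDomain fun t => t.label S T) (fun X => ?_) x y
  · rwa [Finsupp.sum_mapDomain_index (by simp) (by simp [add_mul])] at this
  · rw [Finsupp.sum_mapDomain_index (by simp) (by simp [add_smul])]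
    have := congrArg (fun f => f X) h
    simpa only [Finsupp.sum, LinearMap.sum_apply, LinearMap.smul_apply, effLin_apply,
        LinearMap.zero_apply, Complex.coe_smul] using this

/-- Where every `v i` is real, the real part of the relation is the relation with real parts of
coefficients; such points span. -/
theorem re_sum_eq_zero {I V : Type*} [AddCommGroup V] [Module ℂ V] (v : I → Module.Dual ℂ V)
    {S : Set V} (hS : Submodule.span ℂ S = ⊤) (hv : ∀ i, ∀ X ∈ S, ∃ r : ℝ, v i X = r)
    (β : I →₀ ℂ) (h : (β.sum fun i b => b • v i) = 0) :
    (β.sum fun i b => (b.re : ℂ) • v i) = 0 := by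
  refine LinearMap.ext_on hS fun X hX => ?_
  have h1 := congrArg (fun f => (f X).re) h
  simp only [Finsupp.sum, LinearMap.sum_apply, LinearMap.smul_apply, LinearMap.zero_apply,
    smul_eq_mul, Complex.re_sum, Complex.zero_re] at h1 ⊢
  rw [← Complex.ofReal_zero, ← h1, Complex.ofReal_sum]
  refine Finset.sum_congr rfl fun i _ => ?_
  obtain ⟨r, hr⟩ := hv i X hX
  rw [hr, Complex.re_mul_ofReal, Complex.ofReal_mul]

/-- A real relation among the functionals induced on wire `i` is a relation among effective
processes with only that input open, so `seq_linear` carries it over to the weights at `x`. The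
weights thus extend to a functional on the dual space, which is evaluation at some operator. -/
theorem exists_input_operator (hm : m.Explains F) (i : ι) (x : m.ΛA i) :
    ∃ G : Matrix (HA i) (HA i) ℂ, ∀ t : Circuit HA HB Z C,
      t.inputFunctional F i G = m.inputWeight t i x := by
  obtain ⟨g, hg⟩ : ∃ g : Module.Dual ℂ (Module.Dual ℂ _),
      ∀ t : Circuit HA HB Z C, g (t.inputFunctional F i) = m.inputWeight t i x := by
    refine exists_functional _ _
      (re_sum_eq_zero _ span_pure fun t P hP => hm.exists_real_inputFunctional t i hP.density)
      fun α hα => ?_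
    have hS : ∀ k, k ∈ ({i} : Finset ι) ↔ k = i := by simp
    have hT : ∀ j : κ, j ∉ (∅ : Finset κ) := by simp
    have := hm.eff_linear {i} ∅ α (eq_of_pair_eq fun X D => ?_)
      (fun k => (Finset.mem_singleton.1 k.2).symm ▸ x) (fun j => absurd j.2 (hT _))
    · simpa only [eff_label_input m _ i hS hT] using this
    · have h0 := congrArg (fun f => f (X ⟨i, (hS i).2 rfl⟩)) hα
      rw [← pairMap_apply, ← pairMap_apply, Finsupp.sum, map_sum, map_zero]
      simpa only [Finsupp.sum, LinearMap.sum_apply, LinearMap.smul_apply, LinearMap.zero_apply,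
        map_smul, pairMap_apply, pair_effLin_label_input _ i hS hT] using h0
  refine ⟨(Module.evalEquiv ℂ _).symm g, fun t => ?_⟩
  rw [Module.apply_evalEquiv_symm_apply, hg]

theorem exists_output_operator (hm : m.Explains F) (j : κ) (y : m.ΛB j) :
    ∃ D : Matrix (HB j) (HB j) ℂ, ∀ t : Circuit HA HB Z C,
      t.outputFunctional F j D = m.outputWeight t j y := by
  obtain ⟨g, hg⟩ : ∃ g : Module.Dual ℂ (Module.Dual ℂ _),
      ∀ t : Circuit HA HB Z C, g (t.outputFunctional F j) = m.outputWeight t j y := by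
    refine exists_functional _ _
      (re_sum_eq_zero _ span_pure fun t P hP => hm.exists_real_outputFunctional t j hP.effect)
      fun α hα => ?_
    have hS : ∀ i : ι, i ∉ (∅ : Finset ι) := by simp
    have hT : ∀ k, k ∈ ({j} : Finset κ) ↔ k = j := by simp
    have := hm.eff_linear ∅ {j} α (eq_of_pair_eq fun X D => ?_)
      (fun i => absurd i.2 (hS _)) (fun k => (Finset.mem_singleton.1 k.2).symm ▸ y)
    · simpa only [eff_label_output m _ j hS hT] using this
    · have h0 := congrArg (fun f => f (D ⟨j, (hT j).2 rfl⟩)) hα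
      rw [← pairMap_apply, ← pairMap_apply, Finsupp.sum, map_sum, map_zero]
      simpa only [Finsupp.sum, LinearMap.sum_apply, LinearMap.smul_apply, LinearMap.zero_apply,
        map_smul, pairMap_apply, pair_effLin_label_output _ j hS hT] using h0
  refine ⟨(Module.evalEquiv ℂ _).symm g, fun t => ?_⟩
  rw [Module.apply_evalEquiv_symm_apply, hg]

/-! ### Decomposition into products of local effective processes -/

section Local

/-- The product of the functionals of a family of circuits, one for each input and each output. -/
def localLabels (a : ι → Circuit HA HB Z C) (b : κ → Circuit HA HB Z C) {N : ℕ}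
    (en : ι ⊕ κ ≃ Fin N) (ν : Fin N) :
    Label HA HB Z C (block (fun i => en (.inl i)) ν) (block (fun j => en (.inr j)) ν) :=
  (Sum.elim a b (en.symm ν)).label _ _

theorem pair_parLin_localLabels (a : ι → Circuit HA HB Z C) (b : κ → Circuit HA HB Z C) {N : ℕ}
    (en : ι ⊕ κ ≃ Fin N) (X : ∀ i, Matrix (HA i) (HA i) ℂ) (M : ∀ j, Matrix (HB j) (HB j) ℂ) :
    pair (parLin F (fun i => en (.inl i)) (fun j => en (.inr j)) (localLabels a b en)) X M =
      (∏ i, (a i).inputFunctional F i (X i)) * ∏ j, (b j).outputFunctional F j (M j) := by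
  rw [pair_parLin, ← Equiv.prod_comp en, Fintype.prod_sum_type]
  congr 1
  · refine Finset.prod_congr rfl fun i _ => ?_
    have : localLabels a b en (en (.inl i)) = (a i).label _ _ := by simp [localLabels]
    rw [this, pair_effLin_label_input _ i (by simp [block]) (by simp [block])]
    rfl
  · refine Finset.prod_congr rfl fun j _ => ?_
    have : localLabels a b en (en (.inr j)) = (b j).label _ _ := by simp [localLabels]
    rw [this, pair_effLin_label_output _ j (by simp [block]) (by simp [block])]
    rfl

theorem par_localLabels (a : ι → Circuit HA HB Z C) (b : κ → Circuit HA HB Z C) {N : ℕ}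
    (en : ι ⊕ κ ≃ Fin N) (x : ∀ i, m.ΛA i) (y : ∀ j, m.ΛB j) :
    m.par (fun i => en (.inl i)) (fun j => en (.inr j)) (localLabels a b en) x y =
      (∏ i, m.inputWeight (a i) i (x i)) * ∏ j, m.outputWeight (b j) j (y j) := by
  rw [OntModel.par, ← Equiv.prod_comp en, Fintype.prod_sum_type]
  congr 1
  · refine Finset.prod_congr rfl fun i _ => ?_
    have : localLabels a b en (en (.inl i)) = (a i).label _ _ := by simp [localLabels]
    rw [this, eff_label_input _ _ i (by simp [block]) (by simp [block])]
    rfl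
  · refine Finset.prod_congr rfl fun j _ => ?_
    have : localLabels a b en (en (.inr j)) = (b j).label _ _ := by simp [localLabels]
    rw [this, eff_label_output _ _ j (by simp [block]) (by simp [block])]
    rfl

end Local

/-- Every map of the process is a linear combination of products of local functionals. -/
theorem exists_decomposition (F : Z → C → Op HA →ₗ[ℂ] Op HB) (z : Z) (c : C) :
    ∃ (I : Type (max v w)) (_ : Fintype I) (r : I → ℂ) (a : I → ι → Circuit HA HB Z C)
      (b : I → κ → Circuit HA HB Z C), ∀ X M, pair (F z c) X M =
        ∑ s, r s * ((∏ i, (a s i).inputFunctional F i (X i)) *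
          ∏ j, (b s j).outputFunctional F j (M j)) := by
  choose n l V hV using fun i : ι =>
    exists_interpolation fun t : Circuit HA HB Z C => t.inputFunctional F i
  choose n' l' V' hV' using fun j : κ =>
    exists_interpolation fun t : Circuit HA HB Z C => t.outputFunctional F j
  let π : ∀ i, Matrix (HA i) (HA i) ℂ →ₗ[ℂ] Matrix (HA i) (HA i) ℂ := fun i =>
    ∑ k, ((l i k).inputFunctional F i).smulRight (V i k)
  let π' : ∀ j, Matrix (HB j) (HB j) ℂ →ₗ[ℂ] Matrix (HB j) (HB j) ℂ := fun j =>
    ∑ k, ((l' j k).outputFunctional F j).smulRight (V' j k)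
  have hπ : ∀ i Y, π i Y = ∑ k, (l i k).inputFunctional F i Y • V i k := fun i Y => by
    simp [π, LinearMap.sum_apply]
  have hπ' : ∀ j Y, π' j Y = ∑ k, (l' j k).outputFunctional F j Y • V' j k := fun j Y => by
    simp [π', LinearMap.sum_apply]
  -- For pure arguments the pairing, as a function of slot `i`, is one of the interpolated
  -- functionals, so replacing `X i` by its interpolation changes nothing.
  have h1 : ∀ M X i, pairInput (F z c) M (Function.update X i (π i (X i))) =
      pairInput (F z c) M X := fun M X i => by
    simp only [pairInput_apply]
    refine pair_resolve_input (F z c) i (π i) (fun X M hX hM => ?_) X M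
    rw [← inputFunctional_pureCircuit F hX hM z c, hπ, hV, inputFunctional_pureCircuit,
      Function.update_eq_self]
  have h2 : ∀ X M j, pairOutput (F z c) X (Function.update M j (π' j (M j))) =
      pairOutput (F z c) X M := fun X M j => by
    simp only [pairOutput_apply]
    refine pair_resolve_output (F z c) j (π' j) (fun X M hX hM => ?_) X M
    rw [← outputFunctional_pureCircuit F hX hM z c, hπ', hV', outputFunctional_pureCircuit,
      Function.update_eq_self]
  -- With every slot interpolated, multilinear expansion leaves products of local functionals; the
  -- coefficients are the values of the pairing at the interpolation points.
  refine ⟨(∀ i, Fin (n i)) × (∀ j, Fin (n' j)), inferInstance,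
    fun s => pair (F z c) (fun i => V i (s.1 i)) (fun j => V' j (s.2 j)),
    fun s i => l i (s.1 i), fun s j => l' j (s.2 j), fun X M => ?_⟩
  rw [← pairInput_apply, ← multilinear_resolve _ (fun i => π i) (fun i X => h1 M X i) X
    (fun i => π i (X i)) fun i => .inr rfl, pairInput_apply, ← pairOutput_apply,
    ← multilinear_resolve _ (fun j => π' j) (fun j M => h2 _ M j) M
    (fun j => π' j (M j)) fun j => .inr rfl, pairOutput_apply]
  simp only [hπ, hπ']
  rw [pair_expand, Fintype.sum_prod_type]
  refine Finset.sum_congr rfl fun s _ => Finset.sum_congr rfl fun s' _ => ?_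
  ring

/-- With `F z c` a real combination of products of single-wire effective processes, `par_linear`
gives the same combination for `trans`, with single-wire weights in place of functionals. By `hG`
and `hD` these weights are the functionals evaluated at `G` and `D`. -/
theorem trans_eq_pair (hm : m.Explains F) {G : ∀ i, m.ΛA i → Matrix (HA i) (HA i) ℂ}
    {D : ∀ j, m.ΛB j → Matrix (HB j) (HB j) ℂ}
    (hG : ∀ i x (t : Circuit HA HB Z C), t.inputFunctional F i (G i x) = m.inputWeight t i x)
    (hD : ∀ j y (t : Circuit HA HB Z C), t.outputFunctional F j (D j y) = m.outputWeight t j y)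
    (z : Z) (c : C) (x : ∀ i, m.ΛA i) (y : ∀ j, m.ΛB j) :
    (m.trans z c x y : ℂ) = pair (F z c) (fun i => G i (x i)) (fun j => D j (y j)) := by
  classical
  obtain ⟨I, _, r, a, b, h⟩ := exists_decomposition F z c
  -- Every block of the partition consists of exactly one input or exactly one output.
  let en := Fintype.equivFin (ι ⊕ κ)
  -- The linearity condition admits real coefficients only. On pure operators the pairing and all
  -- local functionals are real, so the coefficients may be replaced by their real parts.
  have hF : F z c = ∑ s, ((r s).re : ℂ) • parLin F (fun i => en (.inl i)) (fun j => en (.inr j))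
      (localLabels (a s) (b s) en) := by
    refine eq_of_pair_eq_pure fun X M hX hM => ?_
    have h1 := h X M
    rw [← pairMap_apply, ← pairMap_apply, map_sum]
    simp only [map_smul, pairMap_apply, pair_parLin_localLabels, smul_eq_mul]
    choose v hv using fun s i => hm.exists_real_inputFunctional (a s i) i (hX i).density
    choose w hw using fun s j => hm.exists_real_outputFunctional (b s j) j (hM j).effect
    have hv' : ∀ s i, (a s i).inputFunctional F i (X i) = v s i := hv
    have hw' : ∀ s j, (b s j).outputFunctional F j (M j) = w s j := hw
    have h2 := hm.pair_circuit (pureCircuit hX hM z c)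
    change pair (F z c) X M = _ at h2
    simp only [hv', hw', ← Complex.ofReal_prod, ← Complex.ofReal_mul] at h1 ⊢
    have h3 := congrArg Complex.re h1
    rw [h2, Complex.ofReal_re, Complex.re_sum] at h3
    rw [h2, h3, Complex.ofReal_sum]
    simp only [Complex.re_mul_ofReal]
  -- The coefficient `-1` at `(z, c)` moves `F z c` to the other side of its decomposition.
  have hlin := hm.par_linear _ (fun i => en (.inl i)) (fun j => en (.inr j))
    (fun z' c' => if z' = z ∧ c' = c then -1 else 0)
    (∑ s, Finsupp.single (localLabels (a s) (b s) en) (r s).re) (fun X => ?_) x y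
  · rw [← Finsupp.sum_finsetSum_index (by simp) (by simp [add_mul])] at hlin
    simp only [ite_and, ite_mul, neg_mul, one_mul, zero_mul, Finset.sum_ite_irrel,
      Finset.sum_const_zero, Finset.sum_ite_eq', Finset.mem_univ, if_true, Finsupp.sum_single_index,
      par_localLabels] at hlin
    have h1 : m.trans z c x y = ∑ s, (r s).re * ((∏ i, m.inputWeight (a s i) i (x i)) *
      ∏ j, m.outputWeight (b s j) j (y j)) := by linarith
    rw [h1, hF, ← pairMap_apply, map_sum, Complex.ofReal_sum]
    refine Finset.sum_congr rfl fun s _ => ?_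
    rw [map_smul, pairMap_apply, pair_parLin_localLabels]
    simp only [hG, hD]
    push_cast
    rfl
  · rw [← Finsupp.sum_finsetSum_index (by simp) (by simp [add_smul])]
    simp only [ite_and, ite_smul, neg_smul, one_smul, zero_smul, Finset.sum_ite_irrel,
      Finset.sum_const_zero, Finset.sum_ite_eq', Finset.mem_univ, if_true, Finsupp.sum_single_index]
    rw [neg_add_eq_zero]
    have := congrArg (fun f => f X) hF
    simpa only [LinearMap.sum_apply, LinearMap.smul_apply, parLin_apply, Complex.coe_smul] using this

theorem isEffect_one (n : Type*) [Fintype n] [DecidableEq n] : IsEffect (1 : Matrix n n ℂ) :=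
  ⟨Matrix.PosSemidef.one, by rw [sub_self]; exact Matrix.PosSemidef.zero⟩

/-- Every classical process has a frame. -/
theorem nonempty_frame (hm : m.Explains F) : Nonempty (Frame F) := by
  choose e he using fun i (x : m.ΛA i) => exists_functional_of_isHermitian
    (p := fun ρ : Matrix (HA i) (HA i) ℂ => IsDensity ρ) (fun ρ hρ => hρ.1.isHermitian)
    (fun ρ => m.prep i ρ x) fun α hα => hm.prep_linear i α hα x
  choose s hs using fun j (y : m.ΛB j) => exists_functional_of_isHermitian
    (p := fun M : Matrix (HB j) (HB j) ℂ => IsEffect M) (fun M hM => hM.1.isHermitian)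
    (fun M => m.resp j M y) fun α hα => hm.resp_linear j α hα y
  choose G hG using fun i => hm.exists_input_operator (i := i)
  choose D hD using fun j => hm.exists_output_operator (j := j)
  have hp := hm.trans_eq_pair hG hD
  exact ⟨{
    ΛA := m.ΛA
    ΛB := m.ΛB
    finA := m.finA
    finB := m.finB
    e := e
    G := G
    s := s
    D := D
    e_nonneg := fun i x P hP => nonneg_of_nonneg_pure _ (fun P hP => by
      have h1 := he i x hP.density
      have h2 := hm.prep_nonneg i hP.density x
      change e i x P = _ at h1
      rw [h1]
      exact_mod_cast h2) hP
    e_sum := fun i X => by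
      have : ∑ x, e i x = Matrix.traceLinearMap _ ℂ ℂ := linearMap_eq_of_eq_pure fun P hP => by
        rw [LinearMap.sum_apply, Matrix.traceLinearMap_apply, hP.1.2]
        have h2 := hm.prep_sum i hP.density
        rw [← Complex.ofReal_inj, Complex.ofReal_sum, Complex.ofReal_one] at h2
        rw [← h2]
        exact Finset.sum_congr rfl fun x _ => he i x hP.density
      simpa using congrArg (fun f => f X) this
    s_nonneg := fun j y P hP => nonneg_of_nonneg_pure _ (fun P hP => by
      have h1 := hs j y hP.effect
      have h2 := hm.resp_nonneg j hP.effect y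
      change s j y P = _ at h1
      rw [h1]
      exact_mod_cast h2) hP
    s_one := fun j y => by
      have h1 := hs j y ⟨1, isEffect_one _⟩
      -- The trivial measurement with the identity as its only effect.
      have h2 := hm.resp_sum j 1 (fun _ => ⟨1, isEffect_one _⟩) (by simp) y
      rw [Finset.univ_unique, Finset.sum_singleton] at h2
      rw [h1, h2, Complex.ofReal_one]
    pair_nonneg := fun z c x y => by
      rw [← hp]
      exact_mod_cast hm.trans_nonneg z c x y
    pair_sum := fun z x => by
      simp only [← hp]
      exact_mod_cast hm.trans_sum z x
    resolveA := fun z c X M i => by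
      let π : Matrix (HA i) (HA i) ℂ →ₗ[ℂ] Matrix (HA i) (HA i) ℂ :=
        ∑ x, (e i x).smulRight (G i x)
      have hπ : ∀ X M, pair (F z c) (Function.update X i (π (X i))) M =
          ∑ x, e i x (X i) * pair (F z c) (Function.update X i (G i x)) M := fun X M => by
        simp only [π, LinearMap.sum_apply, LinearMap.smulRight_apply, ← pairInput_apply]
        rw [MultilinearMap.map_update_sum]
        simp only [MultilinearMap.map_update_smul, smul_eq_mul]
      rw [← hπ]
      refine pair_resolve_input _ i π (fun X M hX hM => ?_) X M
      rw [hπ]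
      have h1 := hm.pair_circuit (pureCircuit hX hM z c)
      -- For pure arguments the model computes the pairing. Splitting the preparation at `i` into
      -- point distributions produces the input weights, which are the values at `G i x`.
      rw [← contract_update_input _ _ _ i] at h1
      change pair (F z c) X M = _ at h1
      rw [h1, Complex.ofReal_sum]
      refine Finset.sum_congr rfl fun x _ => ?_
      rw [← inputFunctional_pureCircuit F hX hM, hG, Complex.ofReal_mul]
      exact congrArg₂ _ (he i x (hX i).density) rfl
    resolveB := fun z c X M j => by
      let π : Matrix (HB j) (HB j) ℂ →ₗ[ℂ] Matrix (HB j) (HB j) ℂ :=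
        ∑ y, (s j y).smulRight (D j y)
      have hπ : ∀ X M, pair (F z c) X (Function.update M j (π (M j))) =
          ∑ y, s j y (M j) * pair (F z c) X (Function.update M j (D j y)) := fun X M => by
        simp only [π, LinearMap.sum_apply, LinearMap.smulRight_apply, ← pairOutput_apply]
        rw [MultilinearMap.map_update_sum]
        simp only [MultilinearMap.map_update_smul, smul_eq_mul]
      rw [← hπ]
      refine pair_resolve_output _ j π (fun X M hX hM => ?_) X M
      rw [hπ]
      have h1 := hm.pair_circuit (pureCircuit hX hM z c)
      rw [← contract_update_output _ _ _ j] at h1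
      change pair (F z c) X M = _ at h1
      rw [h1, Complex.ofReal_sum]
      refine Finset.sum_congr rfl fun y _ => ?_
      rw [← outputFunctional_pureCircuit F hX hM, hD, Complex.ofReal_mul]
      exact congrArg₂ _ (hs j y (hM j).effect) rfl }⟩

end OntModel.Explains

theorem isClassical_iff_nonempty_frame (F : Z → C → Op HA →ₗ[ℂ] Op HB) :
    IsClassical F ↔ Nonempty (Frame F) :=
  ⟨fun ⟨_, hm⟩ => hm.nonempty_frame, fun ⟨φ⟩ => φ.isClassical⟩

end Extract

/-! ### Tensor products of two families -/

section Tensor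

variable {σ τ : Type*} [Fintype σ] [DecidableEq σ] [Fintype τ] [DecidableEq τ]
  {H : σ → Type u} {K : τ → Type u} [∀ i, Fintype (H i)] [∀ j, Fintype (K j)]

/-- Joint values of two families of systems. -/
def partsEquiv (H : σ → Type u) (K : τ → Type u) :
    (∀ p, SumSys H K p) ≃ (∀ i, H i) × (∀ j, K j) where
  toFun s := (leftPart s, rightPart s)
  invFun v := fun p => match p with
    | Sum.inl i => v.1 i
    | Sum.inr j => v.2 j
  left_inv s := by
    funext p
    cases p <;> rfl
  right_inv v := rfl

theorem sum_parts {R : Type*} [AddCommMonoid R] (f : (∀ i, H i) → (∀ j, K j) → R) :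
    ∑ s : ∀ p, SumSys H K p, f (leftPart s) (rightPart s) = ∑ a, ∑ b, f a b := by
  rw [← Fintype.sum_prod_type', ← Equiv.sum_comp (partsEquiv H K)]
  rfl

/-- Local operators on two families of systems. -/
def joinOp (A : ∀ i, Matrix (H i) (H i) ℂ) (B : ∀ j, Matrix (K j) (K j) ℂ) :
    ∀ p, Matrix (SumSys H K p) (SumSys H K p) ℂ
  | Sum.inl i => A i
  | Sum.inr j => B j

/-- The local operators on the first family. -/
def leftOp (M : ∀ p, Matrix (SumSys H K p) (SumSys H K p) ℂ) : ∀ i, Matrix (H i) (H i) ℂ :=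
  fun i => M (Sum.inl i)

/-- The local operators on the second family. -/
def rightOp (M : ∀ p, Matrix (SumSys H K p) (SumSys H K p) ℂ) : ∀ j, Matrix (K j) (K j) ℂ :=
  fun j => M (Sum.inr j)

theorem leftOp_update_inl (M : ∀ p, Matrix (SumSys H K p) (SumSys H K p) ℂ) (i : σ)
    (X : Matrix (H i) (H i) ℂ) :
    leftOp (Function.update M (Sum.inl i) X) = Function.update (leftOp M) i X := by
  funext k
  by_cases h : k = i
  · subst h
    rw [Function.update_self]
    exact Function.update_self (β := fun p => Matrix (SumSys H K p) (SumSys H K p) ℂ) _ _ _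
  · rw [Function.update_of_ne h]
    exact Function.update_of_ne (β := fun p => Matrix (SumSys H K p) (SumSys H K p) ℂ)
      (by simpa using h) _ _

theorem rightOp_update_inr (M : ∀ p, Matrix (SumSys H K p) (SumSys H K p) ℂ) (j : τ)
    (X : Matrix (K j) (K j) ℂ) :
    rightOp (Function.update M (Sum.inr j) X) = Function.update (rightOp M) j X := by
  funext k
  by_cases h : k = j
  · subst h
    rw [Function.update_self]
    exact Function.update_self (β := fun p => Matrix (SumSys H K p) (SumSys H K p) ℂ) _ _ _
  · rw [Function.update_of_ne h]
    exact Function.update_of_ne (β := fun p => Matrix (SumSys H K p) (SumSys H K p) ℂ)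
      (by simpa using h) _ _

theorem rightOp_update_inl (M : ∀ p, Matrix (SumSys H K p) (SumSys H K p) ℂ) (i : σ)
    (X : Matrix (H i) (H i) ℂ) :
    rightOp (Function.update M (Sum.inl i) X) = rightOp M := by
  funext k
  exact Function.update_of_ne (β := fun p => Matrix (SumSys H K p) (SumSys H K p) ℂ)
    (by simp) _ _

theorem leftOp_update_inr (M : ∀ p, Matrix (SumSys H K p) (SumSys H K p) ℂ) (j : τ)
    (X : Matrix (K j) (K j) ℂ) :
    leftOp (Function.update M (Sum.inr j) X) = leftOp M := by
  funext k
  exact Function.update_of_ne (β := fun p => Matrix (SumSys H K p) (SumSys H K p) ℂ)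
    (by simp) _ _

theorem tensorOp_eq_tensor (M : ∀ p, Matrix (SumSys H K p) (SumSys H K p) ℂ) :
    tensorOp M = tensor (tensorOp (leftOp M)) (tensorOp (rightOp M)) := by
  ext s s'
  simp only [tensorOp, tensor, Matrix.of_apply, Fintype.prod_sum_type]
  rfl

theorem trace_tensor_mul (A C : Op H) (B D : Op K) :
    (tensor A B * tensor C D).trace = (A * C).trace * (B * D).trace := by
  simp only [Matrix.trace, Matrix.diag_apply, Matrix.mul_apply, tensor, Matrix.of_apply]
  rw [sum_parts (fun a b => ∑ s' : ∀ p, SumSys H K p, A a (leftPart s') * B b (rightPart s') *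
    (C (leftPart s') a * D (rightPart s') b)), Finset.sum_mul_sum]
  refine Finset.sum_congr rfl fun a _ => Finset.sum_congr rfl fun b _ => ?_
  rw [sum_parts (fun a' b' => A a a' * B b b' * (C a' a * D b' b)), Finset.sum_mul_sum]
  refine Finset.sum_congr rfl fun a' _ => Finset.sum_congr rfl fun b' _ => ?_
  ring

open scoped Kronecker in
theorem posSemidef_tensor {A : Op H} {B : Op K} (hA : A.PosSemidef) (hB : B.PosSemidef) :
    (tensor A B).PosSemidef :=
  (hA.kronecker hB).submatrix (fun s : ∀ p, SumSys H K p => (leftPart s, rightPart s))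

end Tensor

/-! ### Expectation values of product operators in the associated state -/

section Associated

variable {ζ γ ι κ : Type*} [Fintype ζ] [DecidableEq ζ] [Fintype γ] [DecidableEq γ]
  [Fintype ι] [DecidableEq ι] [Fintype κ] [DecidableEq κ]
  {Zv : ζ → Type u} [∀ k, Fintype (Zv k)] [∀ k, DecidableEq (Zv k)]
  {Cv : γ → Type u} [∀ l, Fintype (Cv l)] [∀ l, DecidableEq (Cv l)]
  {HA : ι → Type u} [∀ i, Fintype (HA i)] [∀ i, DecidableEq (HA i)]
  {HB : κ → Type u} [∀ j, Fintype (HB j)] [∀ j, DecidableEq (HB j)]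

theorem tensorOp_transpose (X : ∀ i, Matrix (HA i) (HA i) ℂ) :
    tensorOp (fun i => (X i)ᵀ) = (tensorOp X)ᵀ := rfl

/-- The transposition trick: contracting the copy of an input with `Y` inserts `Yᵀ` into that input,
up to the normalization of the maximally entangled state. -/
theorem trace_mul_choi (A : Op HA →ₗ[ℂ] Op HB)
    (M : ∀ p, Matrix (SumSys HB HA p) (SumSys HB HA p) ℂ) :
    (tensorOp M * choi A).trace = (Fintype.card (∀ i, HA i) : ℂ)⁻¹ *
      pair A (fun i => (rightOp M i)ᵀ) (leftOp M) := by
  have hX : tensorOp (fun i => (rightOp M i)ᵀ) =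
      ∑ a, ∑ a', tensorOp (rightOp M) a' a • Matrix.single a a' (1 : ℂ) := by
    rw [tensorOp_transpose]
    conv_lhs => rw [Matrix.matrix_eq_sum_single (tensorOp (rightOp M))ᵀ]
    simp
  rw [choi, Matrix.mul_smul, Matrix.trace_smul, smul_eq_mul, pair, hX]
  congr 1
  simp only [Matrix.mul_sum, Matrix.trace_sum, map_sum, map_smul, Matrix.mul_smul,
    Matrix.trace_smul]
  refine Finset.sum_congr rfl fun a _ => Finset.sum_congr rfl fun a' _ => ?_
  rw [tensorOp_eq_tensor, trace_tensor_mul, Matrix.trace_mul_single, smul_eq_mul, mul_comm]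
  simp

variable (q : (∀ k, Zv k) → ℝ) (F : (∀ k, Zv k) → (∀ l, Cv l) → Op HA →ₗ[ℂ] Op HB)

/-- The expectation value of a product operator in the associated state. -/
def expect (P : ∀ k, Matrix (Zv k) (Zv k) ℂ) (O : ∀ l, Matrix (Cv l) (Cv l) ℂ)
    (N : ∀ j, Matrix (HB j) (HB j) ℂ) (X : ∀ i, Matrix (HA i) (HA i) ℂ) : ℂ :=
  (Fintype.card (∀ i, HA i) : ℂ)⁻¹ * ∑ z, ∑ c, (∏ k, P k (z k) (z k)) * (∏ l, O l (c l) (c l)) *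
    ((q z : ℂ) * pair (F z c) (fun i => (X i)ᵀ) N)

theorem trace_mul_associatedState
    (M : ∀ p, Matrix (SumSys (SumSys Zv Cv) (SumSys HB HA) p)
      (SumSys (SumSys Zv Cv) (SumSys HB HA) p) ℂ) :
    (tensorOp M * associatedState q F).trace =
      expect q F (leftOp (leftOp M)) (rightOp (leftOp M)) (leftOp (rightOp M))
        (rightOp (rightOp M)) := by
  rw [associatedState, dephase, Matrix.mul_sum, Matrix.trace_sum, tensorOp_eq_tensor,
    tensorOp_eq_tensor (leftOp M)]
  simp only [trace_tensor_mul, flagConvexify, Matrix.trace_mul_single]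
  simp only [← Complex.coe_smul, Matrix.mul_smul, Matrix.trace_smul, trace_mul_choi, tensor,
    Matrix.of_apply, MulOpposite.op_one, one_smul]
  rw [sum_parts (fun z c => tensorOp (leftOp (leftOp M)) z z * tensorOp (rightOp (leftOp M)) c c *
    ((q z : ℂ) • ((Fintype.card (∀ i, HA i) : ℂ)⁻¹ *
      pair (F z c) (fun i => (rightOp (rightOp M) i)ᵀ) (leftOp (rightOp M)))))]
  rw [expect, Finset.mul_sum]
  refine Finset.sum_congr rfl fun z _ => ?_
  rw [Finset.mul_sum]
  refine Finset.sum_congr rfl fun c _ => ?_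
  simp only [tensorOp, Matrix.of_apply, smul_eq_mul]
  ring

theorem pair_stateProcess {σ : Type*} [Fintype σ] [DecidableEq σ] {H : σ → Type u}
    [∀ i, Fintype (H i)] [∀ i, DecidableEq (H i)]
    (ρ : Op H) (a b : Unit) (X : ∀ e, Matrix (NoSys e) (NoSys e) ℂ)
    (M : ∀ i, Matrix (H i) (H i) ℂ) :
    pair (stateProcess ρ a b) X M = (tensorOp M * ρ).trace := by
  simp [pair, stateProcess, trace_tensorOp]

/-! ### The associated state is a density operator -/

theorem posSemidef_choi {A : Op HA →ₗ[ℂ] Op HB} (hA : IsCP A) : (choi A).PosSemidef := by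
  let en := Fintype.equivFin (∀ i, HA i)
  -- The unnormalized maximally entangled vector, with the copy enumerated by `Fin` to match the
  -- ancilla in `IsCP`.
  let w : (∀ i, HA i) × Fin (Fintype.card (∀ i, HA i)) → ℂ := fun p =>
    if en.symm p.2 = p.1 then 1 else 0
  have h := (hA _ _ (Matrix.posSemidef_vecMulVec_self_star w)).submatrix
    (fun s : ∀ p, SumSys HB HA p => (leftPart s, en (rightPart s)))
  rw [choi]
  convert h.smul (inv_natCast_nonneg _)
  ext s s'
  have hs : Matrix.single (rightPart s) (rightPart s') (1 : ℂ) = Matrix.of fun a a' =>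
      Matrix.vecMulVec w (star w) (a, en (rightPart s)) (a', en (rightPart s')) := by
    ext a a'
    simp only [Matrix.single_apply, Matrix.of_apply, Matrix.vecMulVec_apply, w, Pi.star_apply,
      Equiv.symm_apply_apply]
    by_cases h1 : rightPart s = a <;> by_cases h2 : rightPart s' = a' <;> simp [h1, h2]
  simp only [Matrix.sum_apply, tensor, Matrix.of_apply, Matrix.submatrix_apply, amplify, ← hs]
  simp [Matrix.single_apply, ite_and]

theorem posSemidef_associatedState (hF : ∀ z c, IsCP (F z c)) (hq : ∀ z, 0 ≤ q z) :
    (associatedState q F).PosSemidef := by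
  refine Matrix.posSemidef_sum _ fun c _ => posSemidef_tensor ?_ ?_
  · exact posSemidef_single c
  · exact (posSemidef_choi (hF _ _)).smul (hq _)

variable {q F}

/-- Discarding settings, outcomes and outputs leaves the maximally mixed state on the copies, by
trace preservation. -/
theorem expect_one_left (hF : IsProcess F) (hq : ∑ z, q z = 1)
    (X : ∀ i, Matrix (HA i) (HA i) ℂ) :
    expect q F 1 1 1 X = (Fintype.card (∀ i, HA i) : ℂ)⁻¹ * ∏ i, (X i).trace := by
  have h : ∀ z, ∑ c, pair (F z c) (fun i => (X i)ᵀ) 1 = ∏ i, (X i).trace := by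
    intro z
    have := hF.2 z (tensorOp fun i => (X i)ᵀ)
    rw [trace_tensorOp] at this
    simp only [Matrix.trace_transpose] at this
    rw [← this, Matrix.trace_sum]
    refine Finset.sum_congr rfl fun c _ => ?_
    rw [pair]
    erw [tensorOp_one]
    rw [one_mul]
  rw [expect]
  congr 1
  simp only [Pi.one_apply, Matrix.one_apply_eq, Finset.prod_const_one, one_mul]
  simp only [← Finset.mul_sum, h]
  rw [← Finset.sum_mul, ← Complex.ofReal_sum, hq, Complex.ofReal_one, one_mul]

theorem isDensity_associatedState [∀ i, Nonempty (HA i)] (hF : IsProcess F) (hq : ∀ z, 0 ≤ q z)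
    (hq_sum : ∑ z, q z = 1) : IsDensity (associatedState q F) := by
  refine ⟨posSemidef_associatedState q F hF.1 hq, ?_⟩
  have h := trace_mul_associatedState q F fun p => 1
  rw [tensorOp_one, one_mul] at h
  refine h.trans ((expect_one_left hF hq_sum _).trans ?_)
  change _ * ∏ i, (1 : Matrix (HA i) (HA i) ℂ).trace = 1
  simp only [Matrix.trace_one, Fintype.card_pi, Nat.cast_prod]
  exact inv_mul_cancel₀ (Finset.prod_ne_zero_iff.2 fun i _ =>
    Nat.cast_ne_zero.2 Fintype.card_ne_zero)

end Associated

section Resolve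

variable {ι κ : Type*} [Fintype ι] [DecidableEq ι] [Fintype κ] [DecidableEq κ]
  {HA : ι → Type u} [∀ i, Fintype (HA i)] [∀ i, DecidableEq (HA i)]
  {HB : κ → Type u} [∀ j, Fintype (HB j)] [∀ j, DecidableEq (HB j)]

theorem pair_smul_input (A : Op HA →ₗ[ℂ] Op HB) (r : ι → ℂ) (X : ∀ i, Matrix (HA i) (HA i) ℂ)
    (M : ∀ j, Matrix (HB j) (HB j) ℂ) :
    pair A (fun i => r i • X i) M = (∏ i, r i) * pair A X M := by
  rw [← pairInput_apply, MultilinearMap.map_smul_univ, pairInput_apply, smul_eq_mul]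

theorem pair_update_smul_input (A : Op HA →ₗ[ℂ] Op HB) (r : ℂ)
    (X : ∀ i, Matrix (HA i) (HA i) ℂ) (i : ι) (Y : Matrix (HA i) (HA i) ℂ)
    (M : ∀ j, Matrix (HB j) (HB j) ℂ) :
    pair A (Function.update X i (r • Y)) M = r * pair A (Function.update X i Y) M := by
  rw [← pairInput_apply, MultilinearMap.map_update_smul, pairInput_apply, smul_eq_mul]

/-- Since `s j y 1 = 1`, the resolution of the identity is `∑ y, D j y`. Summing over all outputs
therefore amounts to discarding them, which gives the normalization of the coefficients. -/
theorem sum_pair_eq_pair_one (A : Op HA →ₗ[ℂ] Op HB) (X : ∀ i, Matrix (HA i) (HA i) ℂ)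
    {Λ : κ → Type*} [∀ j, Fintype (Λ j)] (s : ∀ j, Λ j → Matrix (HB j) (HB j) ℂ →ₗ[ℂ] ℂ)
    (D : ∀ j, Λ j → Matrix (HB j) (HB j) ℂ) (h1 : ∀ j y, s j y 1 = 1)
    (h : ∀ M j, ∑ y, s j y (M j) * pair A X (Function.update M j (D j y)) = pair A X M) :
    ∑ y : ∀ j, Λ j, pair A X (fun j => D j (y j)) = pair A X 1 := by
  simp only [← pairOutput_apply]
  rw [← MultilinearMap.map_sum]
  refine multilinear_resolve _ (fun j P => ∑ y, s j y P • D j y) (fun j M => ?_) 1 _ fun j => ?_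
  · rw [MultilinearMap.map_update_sum]
    simp only [MultilinearMap.map_update_smul, pairOutput_apply, smul_eq_mul]
    exact h M j
  · right
    simp [h1]

end Resolve

/-! ### Resolving one party of the associated state -/

section Associated

variable {ζ γ ι κ : Type*} [Fintype ζ] [DecidableEq ζ] [Fintype γ] [DecidableEq γ]
  [Fintype ι] [DecidableEq ι] [Fintype κ] [DecidableEq κ]
  {Zv : ζ → Type u} [∀ k, Fintype (Zv k)] [∀ k, DecidableEq (Zv k)]
  {Cv : γ → Type u} [∀ l, Fintype (Cv l)] [∀ l, DecidableEq (Cv l)]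
  {HA : ι → Type u} [∀ i, Fintype (HA i)] [∀ i, DecidableEq (HA i)]
  {HB : κ → Type u} [∀ j, Fintype (HB j)] [∀ j, DecidableEq (HB j)]
  (q : (∀ k, Zv k) → ℝ) (F : (∀ k, Zv k) → (∀ l, Cv l) → Op HA →ₗ[ℂ] Op HB)

theorem prod_diag_single {σ : Type*} [Fintype σ] {H : σ → Type*} [∀ i, DecidableEq (H i)]
    (a b : ∀ i, H i) :
    ∏ i, Matrix.single (a i) (a i) (1 : ℂ) (b i) (b i) = if a = b then 1 else 0 := by
  classical
  simp only [Matrix.single_apply, and_self, Finset.prod_ite_zero, funext_iff]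
  simp

theorem sum_mul_prod_diag_update {σ : Type*} [Fintype σ] [DecidableEq σ] {H : σ → Type*}
    [∀ i, Fintype (H i)] [∀ i, DecidableEq (H i)] (P : ∀ i, Matrix (H i) (H i) ℂ) (i : σ)
    (a : ∀ i, H i) :
    ∑ ξ, P i ξ ξ * ∏ k, Function.update P i (Matrix.single ξ ξ 1) k (a k) (a k) =
      ∏ k, P k (a k) (a k) := by
  have : ∀ ξ, ∏ k, Function.update P i (Matrix.single ξ ξ 1) k (a k) (a k) =
      (if ξ = a i then 1 else 0) * ∏ k ∈ Finset.univ.erase i, P k (a k) (a k) := by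
    intro ξ
    rw [← Finset.mul_prod_erase _ _ (Finset.mem_univ i)]
    congr 1
    · simp [Matrix.single_apply]
    · exact Finset.prod_congr rfl fun k hk => by simp [Finset.ne_of_mem_erase hk]
  simp only [this, ite_mul, one_mul, zero_mul, mul_ite, mul_zero, Finset.sum_ite_eq',
    Finset.mem_univ, if_true]
  rw [← Finset.mul_prod_erase _ _ (Finset.mem_univ i)]

variable (P : ∀ k, Matrix (Zv k) (Zv k) ℂ) (O : ∀ l, Matrix (Cv l) (Cv l) ℂ)
  (N : ∀ j, Matrix (HB j) (HB j) ℂ) (X : ∀ i, Matrix (HA i) (HA i) ℂ)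

theorem expect_single (z : ∀ k, Zv k) (c : ∀ l, Cv l) :
    expect q F (fun k => Matrix.single (z k) (z k) 1) (fun l => Matrix.single (c l) (c l) 1) N X =
      (Fintype.card (∀ i, HA i) : ℂ)⁻¹ * (q z * pair (F z c) (fun i => (X i)ᵀ) N) := by
  simp [expect, prod_diag_single]

/-- Weighted sums of expectation values, computed circuit by circuit. -/
theorem sum_mul_expect_eq {Λ : Type*} [Fintype Λ] (w : Λ → ℂ)
    (P' : Λ → ∀ k, Matrix (Zv k) (Zv k) ℂ) (O' : Λ → ∀ l, Matrix (Cv l) (Cv l) ℂ)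
    (N' : Λ → ∀ j, Matrix (HB j) (HB j) ℂ) (X' : Λ → ∀ i, Matrix (HA i) (HA i) ℂ)
    (h : ∀ z c, ∑ ξ, w ξ * ((∏ k, P' ξ k (z k) (z k)) * (∏ l, O' ξ l (c l) (c l)) *
      pair (F z c) (fun i => (X' ξ i)ᵀ) (N' ξ)) =
        (∏ k, P k (z k) (z k)) * (∏ l, O l (c l) (c l)) * pair (F z c) (fun i => (X i)ᵀ) N) :
    ∑ ξ, w ξ * expect q F (P' ξ) (O' ξ) (N' ξ) (X' ξ) = expect q F P O N X := by
  simp only [expect, mul_left_comm (w _), ← Finset.mul_sum (s := Finset.univ (α := Λ))]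
  congr 1
  simp only [Finset.mul_sum]
  rw [Finset.sum_comm]
  refine Finset.sum_congr rfl fun z _ => ?_
  rw [Finset.sum_comm]
  refine Finset.sum_congr rfl fun c _ => ?_
  rw [mul_left_comm, ← h z c, Finset.mul_sum]
  exact Finset.sum_congr rfl fun ξ _ => by ring

/-- Only the diagonal of the operator on a setting enters, so it may be replaced by its dephased
version. -/
theorem expect_resolve_setting (k : ζ) :
    ∑ ξ, P k ξ ξ * expect q F (Function.update P k (Matrix.single ξ ξ 1)) O N X =
      expect q F P O N X := by
  refine sum_mul_expect_eq q F P O N X _ _ (fun _ => O) (fun _ => N) (fun _ => X) fun z c => ?_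
  simp only [mul_assoc, ← sum_mul_prod_diag_update P k z, Finset.sum_mul]

theorem expect_resolve_outcome (l : γ) :
    ∑ ξ, O l ξ ξ * expect q F P (Function.update O l (Matrix.single ξ ξ 1)) N X =
      expect q F P O N X := by
  refine sum_mul_expect_eq q F P O N X _ (fun _ => P) _ (fun _ => N) (fun _ => X) fun z c => ?_
  simp only [mul_assoc, mul_left_comm (O l _ _), ← Finset.mul_sum]
  rw [← sum_mul_prod_diag_update O l c, Finset.sum_mul]
  simp only [mul_assoc]
  exact congrArg _ (Finset.sum_congr rfl fun ξ _ => by ring)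

variable {q F}

theorem expect_resolve_output (φ : Frame F) (j : κ) :
    ∑ y, φ.s j y (N j) * expect q F P O (Function.update N j (φ.D j y)) X =
      expect q F P O N X := by
  refine sum_mul_expect_eq q F P O N X _ (fun _ => P) (fun _ => O) _ (fun _ => X) fun z c => ?_
  simp only [mul_left_comm (φ.s j _ _), ← Finset.mul_sum]
  rw [φ.resolveB]

theorem transpose_update (i : ι) (Y : Matrix (HA i) (HA i) ℂ) :
    (fun k => (Function.update X i Y k)ᵀ) = Function.update (fun k => (X k)ᵀ) i Yᵀ :=
  funext fun k => Function.apply_update (fun _ Y => Yᵀ) X i Y k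

namespace Frame

/-- The state prepared on the copy of an input conditioned on an outcome of the measurement of a
frame, as a functional. -/
def inputState (φ : Frame F) (i : ι) (x : φ.ΛA i) : Matrix (HA i) (HA i) ℂ →ₗ[ℂ] ℂ :=
  open Classical in
  if φ.e i x 1 = 0 then (Fintype.card (HA i) : ℂ)⁻¹ • Matrix.traceLinearMap _ ℂ ℂ
  else (φ.e i x 1)⁻¹ • (φ.e i x ∘ₗ (Matrix.transposeLinearEquiv _ _ ℂ ℂ).toLinearMap)

/-- If the outcome `x` has weight zero, then `e i x` is zero by positivity, and the default in
`inputState` is irrelevant. -/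
theorem e_one_mul_inputState (φ : Frame F) (i : ι) (x : φ.ΛA i) (Y : Matrix (HA i) (HA i) ℂ) :
    φ.e i x 1 * φ.inputState i x Y = φ.e i x Yᵀ := by
  by_cases h : φ.e i x 1 = 0
  · rw [eq_zero_of_apply_one _ (φ.e_nonneg i x) h]
    simp
  · simp [inputState, h]

theorem inputState_one [∀ i, Nonempty (HA i)] (φ : Frame F) (i : ι) (x : φ.ΛA i) :
    φ.inputState i x 1 = 1 := by
  by_cases h : φ.e i x 1 = 0
  · simp [inputState, h]
  · simp [inputState, h]

theorem inputState_nonneg (φ : Frame F) (i : ι) (x : φ.ΛA i) {Y : Matrix (HA i) (HA i) ℂ}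
    (hY : Y.PosSemidef) : 0 ≤ φ.inputState i x Y := by
  by_cases h : φ.e i x 1 = 0
  · simpa [inputState, h] using
      mul_nonneg (inv_natCast_nonneg (Fintype.card (HA i))) hY.trace_nonneg
  · have h1 := φ.e_nonneg i x 1 Matrix.PosSemidef.one
    have h2 := φ.e_nonneg i x Yᵀ hY.transpose
    simpa [inputState, h] using mul_nonneg (inv_nonneg_of_nonneg h1) h2

end Frame

/-- The factor `e i x 1` moves from the operator to the functional, where it undoes the
normalization; what remains is `resolveA` applied to the transposed operators. -/
theorem expect_resolve_input (φ : Frame F) (i : ι) :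
    ∑ x, φ.inputState i x (X i) *
      expect q F P O N (Function.update X i (φ.e i x 1 • (φ.G i x)ᵀ)) = expect q F P O N X := by
  refine sum_mul_expect_eq q F P O N X _ (fun _ => P) (fun _ => O) (fun _ => N) _ fun z c => ?_
  simp only [mul_left_comm (φ.inputState i _ _), ← Finset.mul_sum]
  rw [← φ.resolveA z c _ _ i]
  congr 1
  refine Finset.sum_congr rfl fun x _ => ?_
  rw [transpose_update, Matrix.transpose_smul, Matrix.transpose_transpose, pair_update_smul_input,
    ← φ.e_one_mul_inputState]
  ring

/-! ### Local updates of product operators on the associated state -/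

section Update

variable (q F) (M : ∀ p, Matrix (SumSys (SumSys Zv Cv) (SumSys HB HA) p)
  (SumSys (SumSys Zv Cv) (SumSys HB HA) p) ℂ)

theorem trace_update_setting (k : ζ) (Y : Matrix (Zv k) (Zv k) ℂ) :
    (tensorOp (Function.update M (.inl (.inl k)) Y) * associatedState q F).trace =
      expect q F (Function.update (leftOp (leftOp M)) k Y) (rightOp (leftOp M))
        (leftOp (rightOp M)) (rightOp (rightOp M)) := by
  have h1 : leftOp (Function.update M (.inl (.inl k)) Y) =
    Function.update (leftOp M) (.inl k) Y := leftOp_update_inl M (.inl k) Y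
  have h2 : rightOp (Function.update M (.inl (.inl k)) Y) = rightOp M :=
    rightOp_update_inl M (.inl k) Y
  rw [trace_mul_associatedState, h1, h2]
  exact congrArg₂ (fun P O => expect q F P O _ _) (leftOp_update_inl (leftOp M) k Y)
    (rightOp_update_inl (leftOp M) k Y)

theorem trace_update_outcome (l : γ) (Y : Matrix (Cv l) (Cv l) ℂ) :
    (tensorOp (Function.update M (.inl (.inr l)) Y) * associatedState q F).trace =
      expect q F (leftOp (leftOp M)) (Function.update (rightOp (leftOp M)) l Y)
        (leftOp (rightOp M)) (rightOp (rightOp M)) := by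
  have h1 : leftOp (Function.update M (.inl (.inr l)) Y) =
    Function.update (leftOp M) (.inr l) Y := leftOp_update_inl M (.inr l) Y
  have h2 : rightOp (Function.update M (.inl (.inr l)) Y) = rightOp M :=
    rightOp_update_inl M (.inr l) Y
  rw [trace_mul_associatedState, h1, h2]
  exact congrArg₂ (fun P O => expect q F P O _ _) (leftOp_update_inr (leftOp M) l Y)
    (rightOp_update_inr (leftOp M) l Y)

theorem trace_update_output (j : κ) (Y : Matrix (HB j) (HB j) ℂ) :
    (tensorOp (Function.update M (.inr (.inl j)) Y) * associatedState q F).trace =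
      expect q F (leftOp (leftOp M)) (rightOp (leftOp M))
        (Function.update (leftOp (rightOp M)) j Y) (rightOp (rightOp M)) := by
  have h1 : leftOp (Function.update M (.inr (.inl j)) Y) = leftOp M :=
    leftOp_update_inr M (.inl j) Y
  have h2 : rightOp (Function.update M (.inr (.inl j)) Y) =
    Function.update (rightOp M) (.inl j) Y := rightOp_update_inr M (.inl j) Y
  rw [trace_mul_associatedState, h1, h2]
  exact congrArg₂ (fun N X => expect q F _ _ N X) (leftOp_update_inl (rightOp M) j Y)
    (rightOp_update_inl (rightOp M) j Y)

theorem trace_update_input (i : ι) (Y : Matrix (HA i) (HA i) ℂ) :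
    (tensorOp (Function.update M (.inr (.inr i)) Y) * associatedState q F).trace =
      expect q F (leftOp (leftOp M)) (rightOp (leftOp M)) (leftOp (rightOp M))
        (Function.update (rightOp (rightOp M)) i Y) := by
  have h1 : leftOp (Function.update M (.inr (.inr i)) Y) = leftOp M :=
    leftOp_update_inr M (.inr i) Y
  have h2 : rightOp (Function.update M (.inr (.inr i)) Y) =
    Function.update (rightOp M) (.inr i) Y := rightOp_update_inr M (.inr i) Y
  rw [trace_mul_associatedState, h1, h2]
  exact congrArg₂ (fun N X => expect q F _ _ N X) (leftOp_update_inr (rightOp M) i Y)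
    (rightOp_update_inr (rightOp M) i Y)

end Update

/-! ### From a frame of the process to a frame of the state -/

namespace Frame

variable (φ : Frame F)

/-- The functionals of the frame of the associated state. -/
def stateFunctional : ∀ p, SumSys (SumSys Zv Cv) (SumSys φ.ΛB φ.ΛA) p →
    Matrix (SumSys (SumSys Zv Cv) (SumSys HB HA) p)
      (SumSys (SumSys Zv Cv) (SumSys HB HA) p) ℂ →ₗ[ℂ] ℂ
  | .inl (.inl k) => fun ξ : Zv k => Matrix.entryLinearMap ℂ ℂ ξ ξ
  | .inl (.inr l) => fun ξ : Cv l => Matrix.entryLinearMap ℂ ℂ ξ ξ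
  | .inr (.inl j) => φ.s j
  | .inr (.inr i) => φ.inputState i

/-- The operators of the frame of the associated state. -/
def stateOperator : ∀ p, SumSys (SumSys Zv Cv) (SumSys φ.ΛB φ.ΛA) p →
    Matrix (SumSys (SumSys Zv Cv) (SumSys HB HA) p)
      (SumSys (SumSys Zv Cv) (SumSys HB HA) p) ℂ
  | .inl (.inl k) => fun ξ : Zv k => Matrix.single ξ ξ (1 : ℂ)
  | .inl (.inr l) => fun ξ : Cv l => Matrix.single ξ ξ (1 : ℂ)
  | .inr (.inl j) => φ.D j
  | .inr (.inr i) => fun x => φ.e i x 1 • (φ.G i x)ᵀ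

theorem stateFunctional_one [∀ i, Nonempty (HA i)] (p)
    (y : SumSys (SumSys Zv Cv) (SumSys φ.ΛB φ.ΛA) p) : φ.stateFunctional p y 1 = 1 := by
  rcases p with (k | l) | (j | i)
  · exact Matrix.one_apply_eq (n := Zv k) y
  · exact Matrix.one_apply_eq (n := Cv l) y
  · exact φ.s_one j y
  · exact φ.inputState_one i y

theorem stateFunctional_nonneg (p) (y : SumSys (SumSys Zv Cv) (SumSys φ.ΛB φ.ΛA) p)
    (P : Matrix (SumSys (SumSys Zv Cv) (SumSys HB HA) p)
      (SumSys (SumSys Zv Cv) (SumSys HB HA) p) ℂ) (hP : P.PosSemidef) :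
    0 ≤ φ.stateFunctional p y P := by
  rcases p with (k | l) | (j | i)
  · exact hP.diag_nonneg
  · exact hP.diag_nonneg
  · exact φ.s_nonneg j y P hP
  · exact φ.inputState_nonneg i y hP

theorem trace_stateOperator_nonneg (hq : ∀ z, 0 ≤ q z)
    (y : ∀ p, SumSys (SumSys Zv Cv) (SumSys φ.ΛB φ.ΛA) p) :
    0 ≤ (tensorOp (fun p => φ.stateOperator p (y p)) * associatedState q F).trace := by
  rw [trace_mul_associatedState]
  have h := expect_single q F (fun j => φ.D j (y (.inr (.inl j))))
    (fun i => φ.e i (y (.inr (.inr i))) 1 • (φ.G i (y (.inr (.inr i))))ᵀ)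
    (leftPart (leftPart y)) (rightPart (leftPart y))
  refine le_of_le_of_eq ?_ h.symm
  simp only [Matrix.transpose_smul, Matrix.transpose_transpose]
  rw [pair_smul_input (F _ _) (fun i => φ.e i (y (.inr (.inr i))) 1)
    (fun i => φ.G i (y (.inr (.inr i))))]
  -- The joint weight is the probability of the setting, times the weights `e(1)` of the inputs,
  -- times a coefficient of the process, over the total dimension.
  refine mul_nonneg (inv_natCast_nonneg _) (mul_nonneg ?_ (mul_nonneg ?_ ?_))
  · exact_mod_cast hq _
  · exact Finset.prod_nonneg fun i _ => φ.e_nonneg i _ 1 Matrix.PosSemidef.one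
  · exact φ.pair_nonneg _ _ (fun i => y (.inr (.inr i))) (fun j => y (.inr (.inl j)))

theorem trace_resolve_state (M : ∀ p, Matrix (SumSys (SumSys Zv Cv) (SumSys HB HA) p)
    (SumSys (SumSys Zv Cv) (SumSys HB HA) p) ℂ) (p) :
    ∑ y : SumSys (SumSys Zv Cv) (SumSys φ.ΛB φ.ΛA) p, φ.stateFunctional p y (M p) *
      (tensorOp (Function.update M p (φ.stateOperator p y)) * associatedState q F).trace =
        (tensorOp M * associatedState q F).trace := by
  rw [trace_mul_associatedState]
  rcases p with (k | l) | (j | i)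
  · refine Eq.trans ?_ (expect_resolve_setting q F _ _ _ _ k)
    exact Finset.sum_congr rfl fun ξ _ => congrArg₂ _ rfl (trace_update_setting q F M k _)
  · refine Eq.trans ?_ (expect_resolve_outcome q F _ _ _ _ l)
    exact Finset.sum_congr rfl fun ξ _ => congrArg₂ _ rfl (trace_update_outcome q F M l _)
  · refine Eq.trans ?_ (expect_resolve_output _ _ _ _ φ j)
    exact Finset.sum_congr rfl fun ξ _ => congrArg₂ _ rfl (trace_update_output q F M j _)
  · refine Eq.trans ?_ (expect_resolve_input _ _ _ _ φ i)
    exact Finset.sum_congr rfl fun ξ _ => congrArg₂ _ rfl (trace_update_input q F M i _)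

/-- The frame of the associated state. -/
def toState [∀ i, Nonempty (HA i)] (hq : ∀ z, 0 ≤ q z)
    (hρ : IsDensity (associatedState q F)) : Frame (stateProcess (associatedState q F)) where
  ΛA := NoSys
  ΛB := SumSys (SumSys Zv Cv) (SumSys φ.ΛB φ.ΛA)
  finA := inferInstance
  finB := inferInstance
  e e := e.elim
  G e := e.elim
  s := φ.stateFunctional
  D := φ.stateOperator
  e_nonneg e := e.elim
  e_sum e := e.elim
  s_nonneg := φ.stateFunctional_nonneg
  s_one := φ.stateFunctional_one
  pair_nonneg _ _ _ y := by
    rw [pair_stateProcess]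
    exact φ.trace_stateOperator_nonneg hq y
  pair_sum _ x := by
    rw [Finset.univ_unique, Finset.sum_singleton, sum_pair_eq_pair_one _ _ φ.stateFunctional _
      φ.stateFunctional_one, pair_stateProcess]
    · refine Eq.trans ?_ hρ.2
      erw [tensorOp_one]
      rw [one_mul]
    · intro M p
      simp only [pair_stateProcess]
      exact φ.trace_resolve_state M p
  resolveA _ _ _ _ e := e.elim
  resolveB _ _ _ M p := by
    simp only [pair_stateProcess]
    exact φ.trace_resolve_state M p

end Frame

end Associated

/-! ### Frames of states -/

namespace Frame

section State

variable {σ : Type*} [Fintype σ] [DecidableEq σ] {H : σ → Type u}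
  [∀ p, Fintype (H p)] [∀ p, DecidableEq (H p)] {ρ : Op H} (ψ : Frame (stateProcess ρ))

theorem trace_resolve (M : ∀ p, Matrix (H p) (H p) ℂ) (p : σ) :
    ∑ y, ψ.s p y (M p) * (tensorOp (Function.update M p (ψ.D p y)) * ρ).trace =
      (tensorOp M * ρ).trace := by
  have := ψ.resolveB () () (fun e => e.elim) M p
  simpa only [pair_stateProcess] using this

theorem trace_operators_nonneg (y : ∀ p, ψ.ΛB p) :
    0 ≤ (tensorOp (fun p => ψ.D p (y p)) * ρ).trace := by
  have := ψ.pair_nonneg () () (fun e => e.elim) y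
  rwa [pair_stateProcess] at this

/-- In each slot `r p` either writes `M p` exactly in frame operators or is its resolution. The
first option is needed for slots that already hold a frame operator. -/
theorem trace_expand (M : ∀ p, Matrix (H p) (H p) ℂ) (r : ∀ p, ψ.ΛB p → ℂ)
    (hr : ∀ p, ∑ y, r p y • ψ.D p y = M p ∨ r p = fun y => ψ.s p y (M p)) :
    (tensorOp M * ρ).trace =
      ∑ y : ∀ p, ψ.ΛB p, (∏ p, r p (y p)) * (tensorOp (fun p => ψ.D p (y p)) * ρ).trace := by
  have h1 := ψ.pair_resolve () () (fun e => e.elim) (fun e => e.elim) M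
    (fun p => ∑ y, r p y • ψ.D p y) (fun e => e.elim) fun p => (hr p).imp id fun h => by rw [h]
  rw [← pair_stateProcess ρ () () (fun e => e.elim) M, ← h1, ← pairOutput_apply,
    multilinear_expand]
  simp only [pairOutput_apply, pair_stateProcess, smul_eq_mul]

/-- Positivity on products of positive operators and operators of the frame. -/
theorem trace_nonneg (M : ∀ p, Matrix (H p) (H p) ℂ)
    (hM : ∀ p, (M p).PosSemidef ∨ ∃ (r : ℂ) (y : ψ.ΛB p), 0 ≤ r ∧ M p = r • ψ.D p y) :
    0 ≤ (tensorOp M * ρ).trace := by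
  classical
  have h : ∀ p, ∃ r : ψ.ΛB p → ℂ, (∀ y, 0 ≤ r y) ∧
      (∑ y, r y • ψ.D p y = M p ∨ r = fun y => ψ.s p y (M p)) := by
    intro p
    rcases hM p with hp | ⟨r, y, hr, hp⟩
    · exact ⟨fun y => ψ.s p y (M p), fun y => ψ.s_nonneg p y _ hp, .inr rfl⟩
    · refine ⟨Pi.single y r, fun y' => ?_, .inl ?_⟩
      · by_cases hy : y' = y
        · subst hy; simpa using hr
        · simp [hy]
      · simp [Pi.single_apply, ite_smul, hp]
  choose r hr hr' using h
  rw [ψ.trace_expand M r hr']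
  exact Finset.sum_nonneg fun y _ =>
    mul_nonneg (Finset.prod_nonneg fun p _ => hr p _) (ψ.trace_operators_nonneg y)

/-- If the weight of an ontic state of one party vanishes, so do all contractions with the
corresponding operator. -/
theorem trace_update_eq_zero (p : σ) (y : ψ.ΛB p)
    (h : (tensorOp (Function.update 1 p (ψ.D p y)) * ρ).trace = 0)
    (M : ∀ p, Matrix (H p) (H p) ℂ) :
    (tensorOp (Function.update M p (ψ.D p y)) * ρ).trace = 0 := by
  classical
  -- The slot `p` is expanded trivially, as a point weight at `y`; the others are resolved.
  have hexp : ∀ M : ∀ p, Matrix (H p) (H p) ℂ,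
      (tensorOp (Function.update M p (ψ.D p y)) * ρ).trace =
        ∑ η : ∀ p, ψ.ΛB p, ((∏ k ∈ Finset.univ.erase p, ψ.s k (η k) (M k)) *
          ((if η p = y then 1 else 0) * (tensorOp (fun p => ψ.D p (η p)) * ρ).trace)) := by
    intro M
    rw [ψ.trace_expand _ (Function.update (fun k η => ψ.s k η (M k)) p (Pi.single y 1))]
    · refine Finset.sum_congr rfl fun η _ => ?_
      rw [← Finset.mul_prod_erase _ _ (Finset.mem_univ p), Function.update_self, mul_comm (_ * _),
        mul_comm _ (Finset.prod _ _), mul_comm, mul_assoc, Pi.single_apply]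
      congr 1
      exact Finset.prod_congr rfl fun k hk => by
        rw [Function.update_of_ne (Finset.ne_of_mem_erase hk)]
    · intro k
      by_cases hk : k = p
      · subst hk
        left
        simp [Pi.single_apply, ite_smul]
      · right
        simp [hk]
  have h0 := h
  rw [hexp] at h0
  simp only [Pi.one_apply, ψ.s_one, Finset.prod_const_one, one_mul] at h0
  -- At `M = 1` all factors `s` equal one, so the vanishing weight is a sum of nonnegative terms,
  -- and each of them vanishes. The same terms occur for every `M`.
  rw [Finset.sum_eq_zero_iff_of_nonneg fun η _ => by
    by_cases hη : η p = y
    · simpa [hη] using ψ.trace_operators_nonneg η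
    · simp [hη]] at h0
  rw [hexp]
  refine Finset.sum_eq_zero fun η hη => ?_
  rw [h0 η hη, mul_zero]

end State

/-! ### From a frame of the state to a frame of the process -/

section Associated

variable {ζ γ ι κ : Type*} [Fintype ζ] [DecidableEq ζ] [Fintype γ] [DecidableEq γ]
  [Fintype ι] [DecidableEq ι] [Fintype κ] [DecidableEq κ]
  {Zv : ζ → Type u} [∀ k, Fintype (Zv k)] [∀ k, DecidableEq (Zv k)]
  {Cv : γ → Type u} [∀ l, Fintype (Cv l)] [∀ l, DecidableEq (Cv l)]
  {HA : ι → Type u} [∀ i, Fintype (HA i)] [∀ i, DecidableEq (HA i)]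
  {HB : κ → Type u} [∀ j, Fintype (HB j)] [∀ j, DecidableEq (HB j)]
  {q : (∀ k, Zv k) → ℝ} {F : (∀ k, Zv k) → (∀ l, Cv l) → Op HA →ₗ[ℂ] Op HB}
  (ψ : Frame (stateProcess (associatedState q F)))

/-- The ontic states of the copies of the inputs. -/
abbrev InputSpace (i : ι) : Type u := ψ.ΛB (.inr (.inr i))

/-- The ontic states of the outputs. -/
abbrev OutputSpace (j : κ) : Type u := ψ.ΛB (.inr (.inl j))

/-- The functionals on the copies of the inputs. -/
def copyFunctional (i : ι) (x : ψ.InputSpace i) : Matrix (HA i) (HA i) ℂ →ₗ[ℂ] ℂ :=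
  ψ.s (.inr (.inr i)) x

/-- The operators on the copies of the inputs. -/
def copyOperator (i : ι) (x : ψ.InputSpace i) : Matrix (HA i) (HA i) ℂ :=
  ψ.D (.inr (.inr i)) x

/-- The functionals on the outputs. -/
def outFunctional (j : κ) (y : ψ.OutputSpace j) : Matrix (HB j) (HB j) ℂ →ₗ[ℂ] ℂ :=
  ψ.s (.inr (.inl j)) y

/-- The operators on the outputs. -/
def outOperator (j : κ) (y : ψ.OutputSpace j) : Matrix (HB j) (HB j) ℂ :=
  ψ.D (.inr (.inl j)) y

variable (P : ∀ k, Matrix (Zv k) (Zv k) ℂ) (O : ∀ l, Matrix (Cv l) (Cv l) ℂ)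
  (N : ∀ j, Matrix (HB j) (HB j) ℂ) (X : ∀ i, Matrix (HA i) (HA i) ℂ)

theorem expect_resolve_copy (i : ι) :
    ∑ x, ψ.copyFunctional i x (X i) *
      expect q F P O N (Function.update X i (ψ.copyOperator i x)) = expect q F P O N X := by
  have h := ψ.trace_resolve (joinOp (joinOp P O) (joinOp N X)) (.inr (.inr i))
  rw [trace_mul_associatedState] at h
  have h1 : ∀ x : ψ.InputSpace i, (tensorOp (Function.update (joinOp (joinOp P O) (joinOp N X))
      (.inr (.inr i)) (ψ.copyOperator i x)) * associatedState q F).trace =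
      expect q F P O N (Function.update X i (ψ.copyOperator i x)) := fun x =>
    trace_update_input q F (joinOp (joinOp P O) (joinOp N X)) i (ψ.copyOperator i x)
  simp only [← h1]
  exact h

theorem expect_resolve_out (j : κ) :
    ∑ y, ψ.outFunctional j y (N j) *
      expect q F P O (Function.update N j (ψ.outOperator j y)) X = expect q F P O N X := by
  have h := ψ.trace_resolve (joinOp (joinOp P O) (joinOp N X)) (.inr (.inl j))
  rw [trace_mul_associatedState] at h
  have h1 : ∀ y : ψ.OutputSpace j, (tensorOp (Function.update (joinOp (joinOp P O) (joinOp N X))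
      (.inr (.inl j)) (ψ.outOperator j y)) * associatedState q F).trace =
      expect q F P O (Function.update N j (ψ.outOperator j y)) X := fun y =>
    trace_update_output q F (joinOp (joinOp P O) (joinOp N X)) j (ψ.outOperator j y)
  simp only [← h1]
  exact h

theorem expect_nonneg (hP : ∀ k, (P k).PosSemidef) (hO : ∀ l, (O l).PosSemidef)
    (hN : ∀ j, (N j).PosSemidef ∨ ∃ (r : ℂ) (y : ψ.OutputSpace j), 0 ≤ r ∧
      N j = r • ψ.outOperator j y)
    (hX : ∀ i, (X i).PosSemidef ∨ ∃ (r : ℂ) (x : ψ.InputSpace i), 0 ≤ r ∧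
      X i = r • ψ.copyOperator i x) : 0 ≤ expect q F P O N X := by
  have h := ψ.trace_nonneg (joinOp (joinOp P O) (joinOp N X)) fun p => by
    rcases p with (k | l) | (j | i)
    · exact .inl (hP k)
    · exact .inl (hO l)
    · exact hN j
    · exact hX i
  rwa [trace_mul_associatedState] at h

/-- Serves the ontic states `x` with traceless `copyOperator i x`, for which no normalized
preparation can be formed. -/
theorem expect_update_copy_eq_zero (i : ι) (x : ψ.InputSpace i)
    (h : expect q F 1 1 1 (Function.update 1 i (ψ.copyOperator i x)) = 0) :
    expect q F P O N (Function.update X i (ψ.copyOperator i x)) = 0 := by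
  have h1 := ψ.trace_update_eq_zero (.inr (.inr i)) x
    ((trace_update_input q F 1 i _).trans h) (joinOp (joinOp P O) (joinOp N X))
  exact (trace_update_input q F (joinOp (joinOp P O) (joinOp N X)) i
    (ψ.copyOperator i x)).symm.trans h1

section

variable [∀ i, Nonempty (HA i)]

theorem expect_update_one (hF : IsProcess F) (hq_sum : ∑ z, q z = 1) (i : ι)
    (Y : Matrix (HA i) (HA i) ℂ) :
    expect q F 1 1 1 (Function.update 1 i Y) = (Fintype.card (HA i) : ℂ)⁻¹ * Y.trace := by
  rw [expect_one_left hF hq_sum, Fintype.card_pi, ← Finset.mul_prod_erase _ _ (Finset.mem_univ i),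
    ← Finset.mul_prod_erase Finset.univ _ (Finset.mem_univ i), Function.update_self]
  have h : ∏ k ∈ Finset.univ.erase i, (Function.update (1 : ∀ k, Matrix (HA k) (HA k) ℂ) i Y k).trace =
      ∏ k ∈ Finset.univ.erase i, (Fintype.card (HA k) : ℂ) :=
    Finset.prod_congr rfl fun k hk => by simp [Finset.ne_of_mem_erase hk]
  have h0 : ∏ k ∈ Finset.univ.erase i, (Fintype.card (HA k) : ℂ) ≠ 0 :=
    Finset.prod_ne_zero_iff.2 fun k _ => Nat.cast_ne_zero.2 Fintype.card_ne_zero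
  have h1 : (Fintype.card (HA i) : ℂ) ≠ 0 := Nat.cast_ne_zero.2 Fintype.card_ne_zero
  rw [h]
  push_cast
  field_simp

/-- The trace is, up to the dimension, the marginal weight of `x`, because the marginal state on the
copy is maximally mixed. -/
theorem trace_copyOperator_nonneg (hF : IsProcess F) (hq_sum : ∑ z, q z = 1) (i : ι)
    (x : ψ.InputSpace i) : 0 ≤ (ψ.copyOperator i x).trace := by
  have h := ψ.expect_nonneg 1 1 1 (Function.update 1 i (ψ.copyOperator i x))
    (fun _ => Matrix.PosSemidef.one) (fun _ => Matrix.PosSemidef.one)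
    (fun _ => .inl Matrix.PosSemidef.one) fun k => by
      by_cases hk : k = i
      · subst hk
        exact .inr ⟨1, x, zero_le_one, by simp⟩
      · left
        rw [Function.update_of_ne hk]
        exact Matrix.PosSemidef.one
  rw [expect_update_one hF hq_sum] at h
  have h1 : (Fintype.card (HA i) : ℂ) ≠ 0 := Nat.cast_ne_zero.2 Fintype.card_ne_zero
  have h2 := mul_nonneg (Nat.cast_nonneg (α := ℂ) (Fintype.card (HA i))) h
  rwa [mul_inv_cancel_left₀ h1] at h2

/-- The measurement on an input that results from the frame of the associated state. -/
def measurement (i : ι) (x : ψ.InputSpace i) : Matrix (HA i) (HA i) ℂ →ₗ[ℂ] ℂ :=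
  (ψ.copyOperator i x).trace •
    (ψ.copyFunctional i x ∘ₗ (Matrix.transposeLinearEquiv _ _ ℂ ℂ).toLinearMap)

theorem measurement_apply (i : ι) (x : ψ.InputSpace i) (Y : Matrix (HA i) (HA i) ℂ) :
    ψ.measurement i x Y = (ψ.copyOperator i x).trace * ψ.copyFunctional i x Yᵀ := rfl

open Classical in
/-- The normalized operators on an input that result from the frame of the associated state. -/
def preparation (i : ι) (x : ψ.InputSpace i) : Matrix (HA i) (HA i) ℂ :=
  if (ψ.copyOperator i x).trace = 0 then (Fintype.card (HA i) : ℂ)⁻¹ • 1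
  else (ψ.copyOperator i x).trace⁻¹ • (ψ.copyOperator i x)ᵀ

theorem trace_preparation (i : ι) (x : ψ.InputSpace i) : (ψ.preparation i x).trace = 1 := by
  by_cases h : (ψ.copyOperator i x).trace = 0
  · simp [preparation, h]
  · simp [preparation, h]

/-- Projecting the classical parties on `z` and `c` isolates `F z c`; full support makes the factor
`q z` invertible. -/
theorem pair_eq_expect (hq : ∀ z, 0 < q z) (z : ∀ k, Zv k) (c : ∀ l, Cv l) :
    pair (F z c) X N = (Fintype.card (∀ i, HA i) : ℂ) * (q z : ℂ)⁻¹ *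
      expect q F (fun k => Matrix.single (z k) (z k) 1) (fun l => Matrix.single (c l) (c l) 1) N
        fun i => (X i)ᵀ := by
  have h1 : (Fintype.card (∀ i, HA i) : ℂ) ≠ 0 := Nat.cast_ne_zero.2 Fintype.card_ne_zero
  have h2 : (q z : ℂ) ≠ 0 := Complex.ofReal_ne_zero.2 (hq z).ne'
  rw [expect_single]
  simp only [Matrix.transpose_transpose]
  field_simp

/-- The trace in the measurement cancels its inverse in the preparation. If the trace is zero, the
measurement vanishes on one side and the contraction with `copyOperator` on the other. -/
theorem pair_resolve_measurement (hF : IsProcess F) (hq : ∀ z, 0 < q z) (hq_sum : ∑ z, q z = 1)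
    (z : ∀ k, Zv k) (c : ∀ l, Cv l) (i : ι) :
    ∑ x, ψ.measurement i x (X i) * pair (F z c) (Function.update X i (ψ.preparation i x)) N =
      pair (F z c) X N := by
  rw [pair_eq_expect _ X hq, ← ψ.expect_resolve_copy _ _ _ _ i, Finset.mul_sum]
  refine Finset.sum_congr rfl fun x _ => ?_
  rw [measurement_apply]
  by_cases h : (ψ.copyOperator i x).trace = 0
  · rw [h, zero_mul, zero_mul, ψ.expect_update_copy_eq_zero, mul_zero, mul_zero]
    rw [expect_update_one hF hq_sum, h, mul_zero]
  · rw [preparation, if_neg h, pair_update_smul_input, pair_eq_expect _ _ hq, transpose_update,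
      Matrix.transpose_transpose]
    field_simp

theorem pair_resolve_out (hq : ∀ z, 0 < q z) (z : ∀ k, Zv k) (c : ∀ l, Cv l) (j : κ) :
    ∑ y, ψ.outFunctional j y (N j) * pair (F z c) X (Function.update N j (ψ.outOperator j y)) =
      pair (F z c) X N := by
  rw [pair_eq_expect N X hq, ← ψ.expect_resolve_out _ _ _ _ j, Finset.mul_sum]
  refine Finset.sum_congr rfl fun x _ => ?_
  rw [pair_eq_expect _ _ hq]
  ring

/-- The frame of the process that results from a frame of the associated state. -/
def ofState (hF : IsProcess F) (hq : ∀ z, 0 < q z) (hq_sum : ∑ z, q z = 1) : Frame F where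
  ΛA := ψ.InputSpace
  ΛB := ψ.OutputSpace
  finA _ := ψ.finB _
  finB _ := ψ.finB _
  e := ψ.measurement
  G := ψ.preparation
  s := ψ.outFunctional
  D := ψ.outOperator
  e_nonneg i x P hP := mul_nonneg (ψ.trace_copyOperator_nonneg hF hq_sum i x)
    (ψ.s_nonneg (.inr (.inr i)) x _ hP.transpose)
  e_sum i X := by
    -- Resolving the copy of input `i` with identities on all other parties gives `∑ x, s x Xᵀ * tr
    -- (D x) = tr X`, up to the dimension.
    have h := ψ.expect_resolve_copy 1 1 1 (Function.update 1 i Xᵀ) i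
    simp only [Function.update_idem, Function.update_self, expect_update_one hF hq_sum] at h
    have h1 : (Fintype.card (HA i) : ℂ) ≠ 0 := Nat.cast_ne_zero.2 Fintype.card_ne_zero
    simp only [mul_left_comm (ψ.copyFunctional i _ _), ← Finset.mul_sum,
      Matrix.trace_transpose] at h
    rw [← mul_left_cancel₀ (inv_ne_zero h1) h]
    exact Finset.sum_congr rfl fun x _ => mul_comm _ _
  s_nonneg j y := ψ.s_nonneg (.inr (.inl j)) y
  s_one j y := ψ.s_one (.inr (.inl j)) y
  pair_nonneg z c x y := by
    rw [pair_eq_expect _ _ hq]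
    refine mul_nonneg (mul_nonneg (Nat.cast_nonneg _) (inv_nonneg_of_nonneg ?_)) ?_
    · exact_mod_cast (hq z).le
    · refine ψ.expect_nonneg _ _ _ _ (fun k => posSemidef_single _) (fun l => posSemidef_single _)
        (fun j => .inr ⟨1, y j, zero_le_one, (one_smul _ _).symm⟩) fun i => ?_
      by_cases h : (ψ.copyOperator i (x i)).trace = 0
      · left
        rw [preparation, if_pos h]
        exact (Matrix.PosSemidef.one.smul (inv_natCast_nonneg _)).transpose
      · right
        refine ⟨(ψ.copyOperator i (x i)).trace⁻¹, x i,
          inv_nonneg_of_nonneg (ψ.trace_copyOperator_nonneg hF hq_sum i _), ?_⟩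
        rw [preparation, if_neg h, Matrix.transpose_smul, Matrix.transpose_transpose]
  pair_sum z x := by
    have h : ∀ c, ∑ y : ∀ j, ψ.OutputSpace j, pair (F z c) (fun i => ψ.preparation i (x i))
        (fun j => ψ.outOperator j (y j)) = (F z c (tensorOp fun i => ψ.preparation i (x i))).trace := by
      intro c
      rw [sum_pair_eq_pair_one _ _ ψ.outFunctional _ fun j y => ψ.s_one (.inr (.inl j)) y]
      · rw [pair]
        erw [tensorOp_one]
        rw [one_mul]
      · exact fun M j => ψ.pair_resolve_out M _ hq z c j
    refine (Finset.sum_congr rfl fun c _ => h c).trans ?_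
    rw [← Matrix.trace_sum, hF.2, trace_tensorOp]
    exact Finset.prod_eq_one fun i _ => ψ.trace_preparation i (x i)
  resolveA z c X M i := ψ.pair_resolve_measurement M X hF hq hq_sum z c i
  resolveB z c X M j := ψ.pair_resolve_out M X hq z c j

end

end Associated

end Frame

end QProc

end

theorem theorem7 {ζ γ ι κ : Type*}
    [Fintype ζ] [DecidableEq ζ] [Fintype γ] [DecidableEq γ]
    [Fintype ι] [DecidableEq ι] [Fintype κ] [DecidableEq κ]
    {Zv : ζ → Type u} [∀ k, Fintype (Zv k)] [∀ k, DecidableEq (Zv k)]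
    {Cv : γ → Type u} [∀ l, Fintype (Cv l)] [∀ l, DecidableEq (Cv l)]
    {HA : ι → Type u} [∀ i, Fintype (HA i)] [∀ i, DecidableEq (HA i)] [∀ i, Nonempty (HA i)]
    {HB : κ → Type u} [∀ j, Fintype (HB j)] [∀ j, DecidableEq (HB j)] [∀ j, Nonempty (HB j)]
    (F : (∀ k, Zv k) → (∀ l, Cv l) → QProc.Op HA →ₗ[ℂ] QProc.Op HB)
    (hF : QProc.IsProcess F)
    (q : (∀ k, Zv k) → ℝ) (hq : ∀ z, 0 < q z) (hq_sum : ∑ z, q z = 1) :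
    QProc.IsDensity (QProc.associatedState q F) ∧
      (QProc.IsNonclassical F ↔
        QProc.IsNonclassical (QProc.stateProcess (QProc.associatedState q F))) := by
  have hρ := QProc.isDensity_associatedState hF (fun z => (hq z).le) hq_sum
  refine ⟨hρ, not_congr ?_⟩
  rw [QProc.isClassical_iff_nonempty_frame, QProc.isClassical_iff_nonempty_frame]
  exact ⟨fun ⟨φ⟩ => ⟨φ.toState (fun z => (hq z).le) hρ⟩, fun ⟨ψ⟩ => ⟨ψ.ofState hF hq hq_sum⟩⟩
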